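/- Let $C_\infty(\mathbb{R}^n)$ be the continuous real functions on $\mathbb{R}^n$ vanishing at infinity, with the sup-norm. Let $(\ell,Q,\nu)$ be a Lévy triplet: $\ell\in\mathbb{R}^n$, $Q\in\mathbb{R}^{n\times n}$ positive semidefinite, and $\nu$ a Borel measure on $\mathbb{R}^n\setminus\{0\}$ with $\int\min\{1,|y|^2\}\,\nu(dy)<\infty$. For $u\in C_c^\infty(\mathbb{R}^n)$ put $$Au(x)=\ell\cdot\nabla u(x)+\tfrac12\operatorname{div}(Q\nabla u)(x)+\int_{y\neq0}\bigl(u(x+y)-u(x)-y\cdot\nabla u(x)\mathbf 1_{(0,1)}(|y|)\bigr)\,\nu(dy),$$ and let the Lévy operator $(A,\mathcal{D}(A))$ be the closure of $(A,C_c^\infty(\mathbb{R}^n))$ in $C_\infty(\mathbb{R}^n)$. Let $(X_t)_{t\ge0}$ be the associated Lévy process, i.e. the process with $X_0=0$, independent and stationary increments and right-continuous trajectories (a.s.) such that $\mathbb{E}\,e^{i\xi\cdot X_t}=e^{-t\psi(\xi)}$, where $$\psi(\xi)=-i\ell\cdot\xi+\tfrac12\,\xi\cdot Q\xi+\int_{y\neq0}\bigl(1-e^{i\xi\cdot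 y}+i\xi\cdot y\,\mathbf 1_{(0,1)}(|y|)\bigr)\,\nu(dy).$$ Suppose that $A$ satisfies the unique continuation principle (UCP): for every non-empty open set $G\subset\mathbb{R}^n$ and every $u\in\mathcal{D}(A)$, if $u|_G=0$ and $(Au)|_G=0$, then $u=0$ on $\mathbb{R}^n$. Then for every $\epsilon>0$ the following hold, where $B_\epsilon(0)$ is the open ball, $\mu(x+\cdot)$ is the measure $B\mapsto\mu(x+B)$, and a set of finite signed measures on the open set $S=\mathbb{R}^n\setminus\overline{B_\epsilon(0)}$ is called vaguely dense if it is dense, in the space of all finite signed measures on $S$, for the weak-$*$ topology generated by the maps $m\mapsto\int\phi\,dm$, $\phi\in C_\infty(S)$ (the continuous functions on $S$ vanishing at infinity on $S$). 1. For every exponentially distributed random variable $\tau$ (of any rate $\lambda>0$) that is independent of $(X_t)_{t\ge0}$, the linear span of $\{\mathrm{Law}(X_\tau)(x+\cdot)|_{\mathbb{R}^n\setminus\overline{B_\epsilon(0)}} : x\in B_\epsilon(0)\}$ is vaguely dense in the finite signed measures on $\mathbb{R}^n\setminus\overline{B_\epsilon(0)}$. 2. The linear span of $\{\mathrm{Law}(X_t)(x+\cdot)|_{\mathbb{R}^n\setminus\overline{B_\epsilon(0)}}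 : x\in B_\epsilon(0),\ t>0\}$ is vaguely dense in the finite signed measures on $\mathbb{R}^n\setminus\overline{B_\epsilon(0)}$. -/

import Mathlib

open MeasureTheory ProbabilityTheory Topology
open scoped ZeroAtInfty NNReal ENNReal RealInnerProductSpace

noncomputable section

/-- The characteristic triplet `(ℓ, Q, ν)` of a Lévy operator on `ℝⁿ`: a vector `ℓ`, a positive
semidefinite matrix `Q`, and a Lévy measure `ν`, i.e. a Borel measure on `ℝⁿ ∖ {0}` (here: a Borel
measure on `ℝⁿ` not charging the origin) with `∫ min {1, |y|²} ν(dy) < ∞`. -/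
structure LevyTriplet (n : ℕ) where
  drift : EuclideanSpace ℝ (Fin n)
  diffusion : Matrix (Fin n) (Fin n) ℝ
  jump : Measure (EuclideanSpace ℝ (Fin n))
  diffusion_posSemidef : diffusion.PosSemidef
  jump_singleton_zero : jump {0} = 0
  lintegral_jump_lt_top : ∫⁻ y, ENNReal.ofReal (min 1 (‖y‖ ^ 2)) ∂jump < ∞

namespace LevyTriplet

variable {n : ℕ} (T : LevyTriplet n)

/-- The integro-differential expression
`Au(x) = ℓ·∇u(x) + ½ div(Q∇u)(x) + ∫ (u(x+y) - u(x) - y·∇u(x) 𝟙_{(0,1)}(|y|)) ν(dy)`.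
It is only ever applied to test functions `u ∈ C_c^∞(ℝⁿ)`, for which the integrand is
`ν`-integrable. -/
def op (u : EuclideanSpace ℝ (Fin n) → ℝ) (x : EuclideanSpace ℝ (Fin n)) : ℝ :=
  fderiv ℝ u x T.drift
    + (1 / 2) * ∑ i, fderiv ℝ
        (fun z => ∑ j, T.diffusion i j * fderiv ℝ u z (EuclideanSpace.single j 1)) x
        (EuclideanSpace.single i 1)
    + ∫ y, (u (x + y) - u x - (if ‖y‖ < 1 then fderiv ℝ u x y else 0)) ∂T.jump

/-- The characteristic exponent
`ψ(ξ) = -i ℓ·ξ + ½ ξ·Qξ + ∫ (1 - e^{i ξ·y} + i ξ·y 𝟙_{(0,1)}(|y|)) ν(dy)`. -/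
def exponent (ξ : EuclideanSpace ℝ (Fin n)) : ℂ :=
  -Complex.I * ((⟪T.drift, ξ⟫ : ℝ) : ℂ)
    + (1 / 2) * ((∑ i, ∑ j, ξ i * T.diffusion i j * ξ j : ℝ) : ℂ)
    + ∫ y, (1 - Complex.exp (Complex.I * ((⟪ξ, y⟫ : ℝ) : ℂ))
        + (if ‖y‖ < 1 then Complex.I * ((⟪ξ, y⟫ : ℝ) : ℂ) else 0)) ∂T.jump

/-- The graph `{(u, Au) | u ∈ C_c^∞(ℝⁿ)}` of the Lévy operator on test functions, as a subset of
`C_∞(ℝⁿ) × C_∞(ℝⁿ)`, where `C_∞(ℝⁿ)` is the space of continuous functions vanishing at infinity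
with the sup-norm. -/
def testGraph : Set (C₀(EuclideanSpace ℝ (Fin n), ℝ) × C₀(EuclideanSpace ℝ (Fin n), ℝ)) :=
  {p | ContDiff ℝ ((⊤ : ℕ∞) : WithTop ℕ∞) p.1 ∧ HasCompactSupport p.1 ∧ ∀ x, p.2 x = T.op p.1 x}

/-- The graph `{(u, Au) | u ∈ 𝒟(A)}` of the Lévy operator `(A, 𝒟(A))` on `C_∞(ℝⁿ)`: the closure of
`(A, C_c^∞(ℝⁿ))`. -/
def graph : Set (C₀(EuclideanSpace ℝ (Fin n), ℝ) × C₀(EuclideanSpace ℝ (Fin n), ℝ)) :=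
  closure T.testGraph

/-- The unique continuation principle: whenever `u ∈ 𝒟(A)` and both `u` and `Au` vanish on some
non-empty open set `G`, then `u = 0` on `ℝⁿ`. -/
def UniqueContinuation : Prop :=
  ∀ G : Set (EuclideanSpace ℝ (Fin n)), IsOpen G → G.Nonempty →
    ∀ u f : C₀(EuclideanSpace ℝ (Fin n), ℝ), (u, f) ∈ T.graph →
      (∀ x ∈ G, f x = 0) → (∀ x ∈ G, u x = 0) → u = 0

end LevyTriplet

/-- `X` is a Lévy process with values in `ℝⁿ` under `P`: it starts at `0`, has independent and
stationary increments and right-continuous trajectories (almost surely). -/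
structure IsLevyProcess {n : ℕ} {Ω : Type*} [MeasurableSpace Ω]
    (X : ℝ≥0 → Ω → EuclideanSpace ℝ (Fin n)) (P : Measure Ω) : Prop where
  measurable : ∀ t, Measurable (X t)
  start : ∀ᵐ ω ∂P, X 0 ω = 0
  indep_increments : HasIndepIncrements X P
  stationary_increments : ∀ s t, IdentDistrib (fun ω => X (s + t) ω - X s ω) (X t) P P
  right_continuous : ∀ᵐ ω ∂P, ∀ t, ContinuousWithinAt (fun s => X s ω) (Set.Ioi t) t

/-- `X` is the Lévy process associated with the Lévy operator with triplet `T`: a Lévy process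
with `𝔼 e^{i ξ·X_t} = e^{-t ψ(ξ)}`. -/
structure IsLevyProcessOf {n : ℕ} (T : LevyTriplet n) {Ω : Type*} [MeasurableSpace Ω]
    (X : ℝ≥0 → Ω → EuclideanSpace ℝ (Fin n)) (P : Measure Ω) : Prop extends
    IsLevyProcess X P where
  charFun_eq : ∀ (t : ℝ≥0) (ξ : EuclideanSpace ℝ (Fin n)),
    charFun (P.map (X t)) ξ = Complex.exp (-(t : ℝ) * T.exponent ξ)

/-- `τ` is exponentially distributed with rate `r`, and independent of the whole process `X`. -/
structure IsIndepExpTime {n : ℕ} {Ω : Type*} [MeasurableSpace Ω]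
    (X : ℝ≥0 → Ω → EuclideanSpace ℝ (Fin n)) (P : Measure Ω) (r : ℝ) (τ : Ω → ℝ≥0) : Prop where
  rate_pos : 0 < r
  measurable : Measurable τ
  law : P.map (fun ω => (τ ω : ℝ)) = expMeasure r
  indep : IndepFun τ (fun ω t => X t ω) P

/-- The open set `ℝⁿ ∖ closedBall 0 ε`. -/
abbrev Exterior (n : ℕ) (ε : ℝ) : Set (EuclideanSpace ℝ (Fin n)) := (Metric.closedBall 0 ε)ᶜ

/-- The restriction to `ℝⁿ ∖ closedBall 0 ε` of the shifted measure `μ(x + ·)`, i.e. the signed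
measure `B ↦ μ (x + B)` on `ℝⁿ ∖ closedBall 0 ε`. -/
def shiftRestrict {n : ℕ} (μ : Measure (EuclideanSpace ℝ (Fin n))) [IsFiniteMeasure μ] (ε : ℝ)
    (x : EuclideanSpace ℝ (Fin n)) : SignedMeasure (Exterior n ε) :=
  (μ.comap (fun y : Exterior n ε => x + (y : EuclideanSpace ℝ (Fin n)))).toSignedMeasure

/-- The vague topology on the finite signed measures on `S`: the coarsest topology for which
`m ↦ ∫ φ dm` is continuous for all `φ ∈ C_∞(S)`, i.e. the weak-* topology for the pairing of
`C_∞(S)` with signed measures. -/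
abbrev vagueTopology (S : Type*) [TopologicalSpace S] [MeasurableSpace S] :
    TopologicalSpace (SignedMeasure S) :=
  TopologicalSpace.induced (fun (m : SignedMeasure S) (φ : C₀(S, ℝ)) => ∫ᵛ y, φ y ∂<•m)
    Pi.topologicalSpace

/-- `M` is vaguely dense in the space of finite signed measures on `S`. -/
def VaguelyDense {S : Type*} [TopologicalSpace S] [MeasurableSpace S]
    (M : Set (SignedMeasure S)) : Prop :=
  @Dense (SignedMeasure S) (vagueTopology S) M

end

/-! By duality, a span of signed measures is vaguely dense as soon as the only φ in `C₀(S, ℝ)` that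
annihilates it is zero. Let φ annihilate the first family and let g be its extension by zero to ℝⁿ,
so that g vanishes on the ball. Annihilation says that u(x) = 𝔼 g(x + X_τ) vanishes on the ball as
well. But u is the resolvent of g: u ∈ 𝒟(A) and Au = r(u - g). Hence u and Au both vanish on the
ball, unique continuation gives u = 0, and as the closure of A is single-valued, r(u - g) = 0, that
is g = 0.

Two facts about A carry this, and both are obtained on the Fourier side. On functions whose Fourier
representation has all moments, A is the multiplier -ψ(-2πξ) (`op_eq`), while averaging over a law
multiplies by its characteristic function. The law of X_τ has characteristic function r/(r + ψ),
which yields the resolvent equation for test functions. Their averages need not have compact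
support, so smooth cutoffs place them in the closure; density of test functions does the rest
(`translateAverage_mem_graph`). Single-valuedness (`eq_zero_of_zero_mem_graph`) follows from
dissipativity, hence from the positive maximum principle, where A is a limit of difference quotients
of averages over X_t.

The second claim reduces to the first: an independent exponential time is adjoined on a product
space, and the average at that time is a limit of mixtures of averages at fixed times t > 0. -/

noncomputable section

open scoped FourierTransform

/-! ### Fourier transforms of functions with all moments finite -/

section FourierRepresentation

variable {V : Type*} [NormedAddCommGroup V] [InnerProductSpace ℝ V] [FiniteDimensional ℝ V]
  [MeasurableSpace V] [BorelSpace V]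

/-- `u` is the real part of the Fourier transform of a function `h` all of whose moments are
finite. -/
structure HasFourierRep (u : V → ℝ) (h : V → ℂ) : Prop where
  aestronglyMeasurable : AEStronglyMeasurable h
  integrable_moment : ∀ k : ℕ, Integrable (fun ξ => ‖ξ‖ ^ k * ‖h ξ‖)
  eq_re : ∀ x, u x = (𝓕 h x).re

namespace HasFourierRep

variable {u : V → ℝ} {h : V → ℂ}

lemma integrable (H : HasFourierRep u h) : Integrable h := by
  have := H.integrable_moment 0
  simp only [pow_zero, one_mul] at this
  exact (integrable_norm_iff H.aestronglyMeasurable).1 this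

lemma coe_eq (H : HasFourierRep u h) : u = Complex.reCLM ∘ 𝓕 h := funext H.eq_re

lemma contDiff_fourier (H : HasFourierRep u h) : ContDiff ℝ ((⊤ : ℕ∞) : WithTop ℕ∞) (𝓕 h) :=
  Real.contDiff_fourier fun n _ => H.integrable_moment n

lemma contDiff (H : HasFourierRep u h) : ContDiff ℝ ((⊤ : ℕ∞) : WithTop ℕ∞) u := by
  rw [H.coe_eq]
  exact Complex.reCLM.contDiff.comp H.contDiff_fourier

/-- All derivatives of a function with a Fourier representation vanish at infinity. -/
lemma tendsto_iteratedFDeriv (H : HasFourierRep u h) (j : ℕ) :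
    Filter.Tendsto (fun x => ‖iteratedFDeriv ℝ j u x‖) (Filter.cocompact V) (𝓝 0) := by
  have key : Filter.Tendsto (iteratedFDeriv ℝ j (𝓕 h)) (Filter.cocompact V) (𝓝 0) := by
    rw [Real.iteratedFDeriv_fourier (N := ⊤) (fun n _ => H.integrable_moment n)
      H.aestronglyMeasurable le_top]
    -- Riemann–Lebesgue lemma.
    exact tendsto_integral_exp_inner_smul_cocompact _
  have h2 : Filter.Tendsto (fun x => ‖Complex.reCLM‖ * ‖iteratedFDeriv ℝ j (𝓕 h) x‖)
      (Filter.cocompact V) (𝓝 0) := by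
    simpa using key.norm.const_mul ‖Complex.reCLM‖
  refine squeeze_zero (fun _ => norm_nonneg _) (fun x => ?_) h2
  rw [H.coe_eq]
  exact Complex.reCLM.norm_iteratedFDeriv_comp_left (N := ((⊤ : ℕ∞) : WithTop ℕ∞))
    H.contDiff_fourier.contDiffAt (by exact_mod_cast le_top)

lemma tendsto_zero (H : HasFourierRep u h) :
    Filter.Tendsto u (Filter.cocompact V) (𝓝 0) := by
  rw [tendsto_zero_iff_norm_tendsto_zero]
  simpa using H.tendsto_iteratedFDeriv 0

/-- Polynomial growth only shifts the moments, so the class is stable under derivatives, the Lévy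
operator and averages alike. -/
lemma mul (H : HasFourierRep u h) {m : V → ℂ} (hm : AEStronglyMeasurable m)
    {C : ℝ} {N : ℕ} (hC : ∀ ξ, ‖m ξ‖ ≤ C * (1 + ‖ξ‖ ^ N)) :
    HasFourierRep (fun x => (𝓕 (fun ξ => m ξ * h ξ) x).re) (fun ξ => m ξ * h ξ) where
  aestronglyMeasurable := hm.mul H.aestronglyMeasurable
  integrable_moment k := by
    have := ((H.integrable_moment k).add (H.integrable_moment (k + N))).const_mul C
    refine this.mono' ?_ (Filter.Eventually.of_forall fun ξ => ?_)
    · exact (by fun_prop : Continuous fun ξ : V => ‖ξ‖ ^ k).aestronglyMeasurable.mul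
        (hm.mul H.aestronglyMeasurable).norm
    · simp only [Pi.add_apply]
      rw [Real.norm_of_nonneg (by positivity), norm_mul]
      calc ‖ξ‖ ^ k * (‖m ξ‖ * ‖h ξ‖) ≤ ‖ξ‖ ^ k * ((C * (1 + ‖ξ‖ ^ N)) * ‖h ξ‖) := by
            gcongr; exact hC ξ
        _ = _ := by ring
  eq_re _ := rfl

lemma fderiv_eq (H : HasFourierRep u h) (v x : V) :
    fderiv ℝ u x v = (𝓕 (fun ξ => (-(2 * Real.pi * Complex.I) * (⟪ξ, v⟫ : ℝ)) * h ξ) x).re := by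
  have hi : Integrable (fun ξ => ‖ξ‖ * ‖h ξ‖) := by simpa using H.integrable_moment 1
  have hd := Real.hasFDerivAt_fourier H.integrable hi x
  have hint : Integrable (VectorFourier.fourierSMulRight (innerSL ℝ) h) := by
    refine (hi.const_mul (2 * Real.pi * ‖innerSL ℝ (E := V)‖)).mono'
      H.aestronglyMeasurable.fourierSMulRight (Filter.Eventually.of_forall fun ξ => ?_)
    exact (VectorFourier.norm_fourierSMulRight_le _ _ _).trans (le_of_eq (by ring))
  rw [H.coe_eq, (Complex.reCLM.hasFDerivAt.comp x hd).fderiv, ContinuousLinearMap.comp_apply,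
    Complex.reCLM_apply, Real.fourier_eq, Real.fourier_eq, ContinuousLinearMap.integral_apply]
  · congr 2
    ext ξ
    change 𝐞 (-⟪ξ, x⟫) • (VectorFourier.fourierSMulRight (innerSL ℝ) h ξ v) = _
    rw [VectorFourier.fourierSMulRight_apply, innerSL_apply_apply, Complex.real_smul, smul_eq_mul]
    ring_nf
  · exact (Real.fourierIntegral_convergent_iff x).2 hint

lemma fderiv (H : HasFourierRep u h) (v : V) :
    HasFourierRep (fun x => fderiv ℝ u x v)
      (fun ξ => (-(2 * Real.pi * Complex.I) * (⟪ξ, v⟫ : ℝ)) * h ξ) := by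
  have hb : ∀ ξ : V, ‖(-(2 * Real.pi * Complex.I) * (⟪ξ, v⟫ : ℝ) : ℂ)‖
      ≤ (2 * Real.pi * ‖v‖) * (1 + ‖ξ‖ ^ 1) := by
    intro ξ
    have := norm_inner_le_norm (𝕜 := ℝ) ξ v
    simp only [norm_mul, norm_neg, Complex.norm_I, Complex.norm_real, Complex.norm_ofNat, mul_one,
      pow_one]
    rw [Real.norm_of_nonneg Real.pi_pos.le]
    have hpi := Real.pi_pos
    calc 2 * Real.pi * ‖⟪ξ, v⟫‖ ≤ 2 * Real.pi * (‖ξ‖ * ‖v‖) := by gcongr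
      _ ≤ 2 * Real.pi * ((1 + ‖ξ‖) * ‖v‖) := by gcongr; linarith
      _ = _ := by ring
  have := H.mul (m := fun ξ => -(2 * Real.pi * Complex.I) * (⟪ξ, v⟫ : ℝ)) (by fun_prop) hb
  simp_rw [← H.fderiv_eq v] at this
  exact this

lemma add {u' : V → ℝ} {h' : V → ℂ} (H : HasFourierRep u h) (H' : HasFourierRep u' h') :
    HasFourierRep (fun x => u x + u' x) (fun ξ => h ξ + h' ξ) where
  aestronglyMeasurable := H.aestronglyMeasurable.add H'.aestronglyMeasurable
  integrable_moment k := by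
    refine ((H.integrable_moment k).add (H'.integrable_moment k)).mono' ?_
      (Filter.Eventually.of_forall fun ξ => ?_)
    · exact (by fun_prop : Continuous fun ξ : V => ‖ξ‖ ^ k).aestronglyMeasurable.mul
        (H.aestronglyMeasurable.add H'.aestronglyMeasurable).norm
    · simp only [Pi.add_apply]
      rw [Real.norm_of_nonneg (by positivity), ← mul_add]
      gcongr
      exact norm_add_le _ _
  eq_re x := by
    rw [H.eq_re, H'.eq_re, ← Complex.add_re]
    congr 1
    simp only [Real.fourier_eq, smul_add]
    rw [integral_add] <;> exact (Real.fourierIntegral_convergent_iff x).2 (by first | exact H.integrable | exact H'.integrable)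

lemma const_mul (H : HasFourierRep u h) (c : ℝ) :
    HasFourierRep (fun x => c * u x) (fun ξ => (c : ℂ) * h ξ) := by
  have := H.mul (m := fun _ => (c : ℂ)) (by fun_prop) (C := |c|) (N := 0) (fun ξ => by
    simp; linarith [abs_nonneg c])
  convert this using 2 with x
  rw [H.eq_re, Real.fourier_eq, Real.fourier_eq]
  rw [← Complex.re_ofReal_mul, ← integral_const_mul]
  congr 2 with ξ
  simp only [Circle.smul_def, smul_eq_mul]
  ring

lemma sum {ι : Type*} (s : Finset ι) {u : ι → V → ℝ} {h : ι → V → ℂ}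
    (H : ∀ i ∈ s, HasFourierRep (u i) (h i)) :
    HasFourierRep (fun x => ∑ i ∈ s, u i x) (fun ξ => ∑ i ∈ s, h i ξ) := by
  classical
  induction s using Finset.induction_on with
  | empty => exact ⟨by simpa using aestronglyMeasurable_const, by simp, by simp [Real.fourier_eq]⟩
  | insert a s ha ih =>
    simp_rw [Finset.sum_insert ha]
    exact (H _ (Finset.mem_insert_self _ _)).add
      (ih fun i hi => H i (Finset.mem_insert_of_mem hi))

end HasFourierRep

/-- Smooth compactly supported functions have a Fourier representation. -/
lemma HasCompactSupport.exists_hasFourierRep {u : V → ℝ} (hu : HasCompactSupport u)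
    (hu' : ContDiff ℝ ((⊤ : ℕ∞) : WithTop ℕ∞) u) : ∃ h : V → ℂ, HasFourierRep u h := by
  have h1 : HasCompactSupport (fun x => (u x : ℂ)) := hu.comp_left (g := ((↑) : ℝ → ℂ)) (by simp)
  have h2 : ContDiff ℝ ((⊤ : ℕ∞) : WithTop ℕ∞) (fun x => (u x : ℂ)) :=
    Complex.ofRealCLM.contDiff.comp hu'
  let f : SchwartzMap V ℂ := h1.toSchwartzMap h2
  let g : SchwartzMap V ℂ := 𝓕⁻ f
  have hf : 𝓕 g = f := FourierInvPair.fourier_fourierInv_eq f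
  refine ⟨g, g.continuous.aestronglyMeasurable, fun k => g.integrable_pow_mul volume k,
    fun x => ?_⟩
  have := congrArg (fun g : SchwartzMap V ℂ => g x) hf
  simp only [SchwartzMap.fourier_coe] at this
  rw [this]
  simp [f]

end FourierRepresentation

/-! ### Growth of the exponent; the Lévy operator as a Fourier multiplier -/

lemma Complex.norm_one_sub_exp_I_mul_add_le (a : ℝ) :
    ‖1 - Complex.exp (Complex.I * (a : ℂ)) + Complex.I * (a : ℂ)‖ ≤ 3 * a ^ 2 := by
  have hn : ‖Complex.I * (a : ℂ)‖ = |a| := by simp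
  rcases le_or_gt |a| 1 with ha | ha
  · have h := Complex.norm_exp_sub_one_sub_id_le (x := Complex.I * (a : ℂ)) (by rwa [hn])
    rw [hn, sq_abs] at h
    rw [← norm_neg]
    calc _ = ‖Complex.exp (Complex.I * (a : ℂ)) - 1 - Complex.I * (a : ℂ)‖ := by
          congr 1; ring
      _ ≤ _ := h.trans (by nlinarith [sq_nonneg a])
  · have h1 : ‖Complex.exp (Complex.I * (a : ℂ))‖ = 1 := by
      rw [mul_comm]; exact Complex.norm_exp_ofReal_mul_I a
    calc _ ≤ ‖(1 : ℂ)‖ + ‖Complex.exp (Complex.I * (a : ℂ))‖ + ‖Complex.I * (a : ℂ)‖ :=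
          (norm_add_le _ _).trans (by gcongr; exact norm_sub_le _ _)
      _ = 2 + |a| := by rw [h1, hn, norm_one]; norm_num
      _ ≤ 3 * |a| ^ 2 := by nlinarith
      _ = _ := by rw [sq_abs]

namespace LevyTriplet

variable {n : ℕ} (T : LevyTriplet n)

lemma integrable_min : Integrable (fun y => min 1 (‖y‖ ^ 2)) T.jump := by
  refine ⟨by fun_prop, ?_⟩
  rw [hasFiniteIntegral_iff_ofReal (Filter.Eventually.of_forall fun y => by positivity)]
  exact T.lintegral_jump_lt_top

/-- Needed for Fubini in the jump integral. The weight min(1, |y|²) is integrable and positive off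
the origin, and the origin is a null set. -/
instance sigmaFinite_jump : SigmaFinite T.jump := by
  have h0 : ∀ᵐ y ∂T.jump, min 1 (‖y‖ ^ 2) ≠ 0 := by
    rw [ae_iff]
    refine measure_mono_null (fun y hy => ?_) T.jump_singleton_zero
    simp only [ne_eq, not_not, Set.mem_ofPred_eq] at hy
    rcases min_choice 1 (‖y‖ ^ 2) with h | h <;> rw [h] at hy
    · norm_num at hy
    · simpa using hy
  have hs : ∀ k : ℕ, T.jump {y | 1 / ((k : ℝ) + 1) ≤ min 1 (‖y‖ ^ 2)} < ∞ := fun k => by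
    have := T.integrable_min.measure_norm_ge_lt_top (ε := 1 / ((k : ℝ) + 1)) (by positivity)
    refine (measure_mono fun y hy => ?_).trans_lt this
    simp only [Set.mem_ofPred_eq] at hy ⊢
    exact le_trans hy (le_abs_self _)
  refine ⟨⟨⟨fun k => {y | 1 / ((k : ℝ) + 1) ≤ min 1 (‖y‖ ^ 2)} ∪ {0}, fun _ => trivial,
    fun k => ?_, ?_⟩⟩⟩
  · exact (measure_union_le _ _).trans_lt (by simpa [T.jump_singleton_zero] using hs k)
  · refine Set.eq_univ_of_forall fun y => Set.mem_iUnion.2 ?_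
    rcases eq_or_ne y 0 with rfl | hy
    · exact ⟨0, Or.inr rfl⟩
    · have : 0 < min 1 (‖y‖ ^ 2) := lt_min one_pos (by positivity)
      obtain ⟨k, hk⟩ := exists_nat_one_div_lt this
      exact ⟨k, Or.inl hk.le⟩

/-- The integrand in the Lévy–Khintchine formula. -/
def jumpKernel (ξ y : EuclideanSpace ℝ (Fin n)) : ℂ :=
  1 - Complex.exp (Complex.I * ((⟪ξ, y⟫ : ℝ) : ℂ))
    + (if ‖y‖ < 1 then Complex.I * ((⟪ξ, y⟫ : ℝ) : ℂ) else 0)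

/-- For |y| < 1 the compensator cancels the first order and leaves 3(ξ·y)²; elsewhere the kernel is
bounded by 2. The separated form serves both integrability in y and quadratic growth in ξ. -/
lemma norm_jumpKernel_le (ξ y : EuclideanSpace ℝ (Fin n)) :
    ‖jumpKernel ξ y‖ ≤ 3 * (1 + ‖ξ‖ ^ 2) * min 1 (‖y‖ ^ 2) := by
  rw [jumpKernel]
  split_ifs with hy
  · have h1 : ‖y‖ ^ 2 ≤ 1 := by nlinarith [norm_nonneg y]
    rw [min_eq_right h1]
    refine (Complex.norm_one_sub_exp_I_mul_add_le _).trans ?_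
    have h2 : ⟪ξ, y⟫ ^ 2 ≤ (‖ξ‖ * ‖y‖) ^ 2 := by
      rw [← sq_abs]
      gcongr
      exact abs_real_inner_le_norm ξ y
    nlinarith [sq_nonneg ‖y‖]
  · have h1 : 1 ≤ ‖y‖ ^ 2 := by nlinarith [norm_nonneg y]
    rw [min_eq_left h1, add_zero]
    have h2 : ‖Complex.exp (Complex.I * ((⟪ξ, y⟫ : ℝ) : ℂ))‖ = 1 := by
      rw [mul_comm]; exact Complex.norm_exp_ofReal_mul_I _
    refine (norm_sub_le _ _).trans ?_
    rw [h2, norm_one]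
    nlinarith [sq_nonneg ‖ξ‖]

lemma measurable_jumpKernel : Measurable (fun p : EuclideanSpace ℝ (Fin n) ×
    EuclideanSpace ℝ (Fin n) => jumpKernel p.1 p.2) := by
  unfold jumpKernel
  refine Measurable.add (by fun_prop) (Measurable.ite ?_ (by fun_prop) (by fun_prop))
  exact measurableSet_lt (by fun_prop) (by fun_prop)

/-- The jump part of the characteristic exponent. -/
def jumpExponent (ξ : EuclideanSpace ℝ (Fin n)) : ℂ := ∫ y, jumpKernel ξ y ∂T.jump

lemma measurable_jumpExponent : Measurable T.jumpExponent :=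
  (measurable_jumpKernel.stronglyMeasurable.integral_prod_right').measurable

lemma norm_jumpExponent_le (ξ : EuclideanSpace ℝ (Fin n)) :
    ‖T.jumpExponent ξ‖ ≤ (3 * ∫ y, min 1 (‖y‖ ^ 2) ∂T.jump) * (1 + ‖ξ‖ ^ 2) := by
  refine (norm_integral_le_of_norm_le (T.integrable_min.const_mul (3 * (1 + ‖ξ‖ ^ 2)))
    (Filter.Eventually.of_forall fun y => norm_jumpKernel_le ξ y)).trans (le_of_eq ?_)
  rw [integral_const_mul]; ring

lemma exponent_eq (ξ : EuclideanSpace ℝ (Fin n)) : T.exponent ξ =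
    -Complex.I * ((⟪T.drift, ξ⟫ : ℝ) : ℂ)
    + (1 / 2) * ((∑ i, ∑ j, ξ i * T.diffusion i j * ξ j : ℝ) : ℂ) + T.jumpExponent ξ := rfl

lemma measurable_exponent : Measurable T.exponent := by
  have := T.measurable_jumpExponent
  simp_rw [funext T.exponent_eq]
  fun_prop

lemma exists_norm_exponent_le : ∃ C, ∀ ξ, ‖T.exponent ξ‖ ≤ C * (1 + ‖ξ‖ ^ 2) := by
  refine ⟨‖T.drift‖ + (∑ i, ∑ j, |T.diffusion i j|) + (3 * ∫ y, min 1 (‖y‖ ^ 2) ∂T.jump),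
    fun ξ => ?_⟩
  have h1 : ‖-Complex.I * ((⟪T.drift, ξ⟫ : ℝ) : ℂ)‖ ≤ ‖T.drift‖ * (1 + ‖ξ‖ ^ 2) := by
    rw [norm_mul, norm_neg, Complex.norm_I, one_mul, Complex.norm_real]
    refine (norm_inner_le_norm _ _).trans ?_
    gcongr
    nlinarith [sq_nonneg (‖ξ‖ - 1)]
  have h2 : ‖(1 / 2 : ℂ) * ((∑ i, ∑ j, ξ i * T.diffusion i j * ξ j : ℝ) : ℂ)‖
      ≤ (∑ i, ∑ j, |T.diffusion i j|) * (1 + ‖ξ‖ ^ 2) := by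
    rw [norm_mul, Complex.norm_real]
    have : ‖∑ i, ∑ j, ξ i * T.diffusion i j * ξ j‖
        ≤ (∑ i, ∑ j, |T.diffusion i j|) * (1 + ‖ξ‖ ^ 2) := by
      simp_rw [Finset.sum_mul]
      refine (norm_sum_le _ _).trans (Finset.sum_le_sum fun i _ => ?_)
      refine (norm_sum_le _ _).trans (Finset.sum_le_sum fun j _ => ?_)
      have hi := PiLp.norm_apply_le ξ i
      have hj := PiLp.norm_apply_le ξ j
      rw [norm_mul, norm_mul, Real.norm_eq_abs (T.diffusion i j)]
      calc ‖ξ i‖ * |T.diffusion i j| * ‖ξ j‖ ≤ ‖ξ‖ * |T.diffusion i j| * ‖ξ‖ := by gcongr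
        _ = |T.diffusion i j| * ‖ξ‖ ^ 2 := by ring
        _ ≤ _ := by gcongr; linarith
    have h3 : ‖(1 / 2 : ℂ)‖ ≤ 1 := by norm_num
    calc _ ≤ 1 * ‖∑ i, ∑ j, ξ i * T.diffusion i j * ξ j‖ := by gcongr
      _ ≤ _ := by rwa [one_mul]
  rw [exponent_eq, add_mul, add_mul]
  exact (norm_add_le _ _).trans (add_le_add ((norm_add_le _ _).trans (add_le_add h1 h2))
    (T.norm_jumpExponent_le ξ))

/-- The Fourier symbol of `-A` for Mathlib's normalization of the Fourier transform. -/
def symbol (ξ : EuclideanSpace ℝ (Fin n)) : ℂ := T.exponent (-(2 * Real.pi) • ξ)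

lemma measurable_symbol : Measurable T.symbol :=
  T.measurable_exponent.comp (by fun_prop)

lemma norm_scaled_le {f : EuclideanSpace ℝ (Fin n) → ℂ} {C : ℝ}
    (hf : ∀ ξ, ‖f ξ‖ ≤ C * (1 + ‖ξ‖ ^ 2)) (ξ : EuclideanSpace ℝ (Fin n)) :
    ‖f (-(2 * Real.pi) • ξ)‖ ≤ (C * (2 * Real.pi) ^ 2) * (1 + ‖ξ‖ ^ 2) := by
  have hC : 0 ≤ C := by simpa using (norm_nonneg _).trans (hf 0)
  refine (hf _).trans ?_
  rw [norm_smul, norm_neg, Real.norm_of_nonneg (by positivity), mul_pow, mul_assoc]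
  have h1 : 1 ≤ (2 * Real.pi) ^ 2 := by nlinarith [Real.pi_gt_three]
  gcongr
  linarith

lemma exists_norm_symbol_le : ∃ C, ∀ ξ, ‖T.symbol ξ‖ ≤ C * (1 + ‖ξ‖ ^ 2) := by
  obtain ⟨C, hC⟩ := T.exists_norm_exponent_le
  exact ⟨_, norm_scaled_le hC⟩

section Op

variable {T} {u : EuclideanSpace ℝ (Fin n) → ℝ} {h : EuclideanSpace ℝ (Fin n) → ℂ}

/-- Translation by y multiplies h by exp(-2πi ξ·y) and the derivative along y multiplies it by -2πi
ξ·y; together they form minus the Lévy–Khintchine kernel at -2πξ. -/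
lemma jump_integrand_eq (H : HasFourierRep u h) (x y : EuclideanSpace ℝ (Fin n)) :
    u (x + y) - u x - (if ‖y‖ < 1 then fderiv ℝ u x y else 0)
      = (∫ ξ, 𝐞 (-⟪ξ, x⟫) • (-jumpKernel (-(2 * Real.pi) • ξ) y * h ξ)).re := by
  have e1 : fderiv ℝ u x y = _ := H.fderiv_eq y x
  have i0 : ∀ z, Integrable fun ξ => 𝐞 (-⟪ξ, z⟫) • h ξ := fun z =>
    (Real.fourierIntegral_convergent_iff z).2 H.integrable
  have i3 : Integrable fun ξ => 𝐞 (-⟪ξ, x + y⟫) • h ξ - 𝐞 (-⟪ξ, x⟫) • h ξ := (i0 _).sub (i0 _)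
  have i1 := (Real.fourierIntegral_convergent_iff x).2 (H.fderiv y).integrable
  have i2 : Integrable fun ξ => if ‖y‖ < 1 then
      𝐞 (-⟪ξ, x⟫) • ((-(2 * Real.pi * Complex.I) * (⟪ξ, y⟫ : ℝ)) * h ξ) else 0 := by
    split_ifs
    · exact i1
    · exact integrable_zero _ _ _
  have e2 : (if ‖y‖ < 1 then fderiv ℝ u x y else 0) = (∫ ξ, if ‖y‖ < 1 then
      𝐞 (-⟪ξ, x⟫) • ((-(2 * Real.pi * Complex.I) * (⟪ξ, y⟫ : ℝ)) * h ξ) else 0).re := by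
    split_ifs
    · rw [e1, Real.fourier_eq]
    · simp
  rw [e2, H.eq_re, H.eq_re, Real.fourier_eq, Real.fourier_eq, ← Complex.sub_re, ← Complex.sub_re,
    ← integral_sub (i0 _) (i0 _), ← integral_sub i3 i2]
  congr 2 with ξ
  have e3 : (𝐞 (-⟪ξ, x + y⟫) : ℂ) = 𝐞 (-⟪ξ, x⟫) *
      Complex.exp (Complex.I * ((⟪-(2 * Real.pi) • ξ, y⟫ : ℝ) : ℂ)) := by
    rw [Real.fourierChar_apply, Real.fourierChar_apply, ← Complex.exp_add, inner_add_right,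
      real_inner_smul_left]
    congr 1
    push_cast
    ring
  simp only [Circle.smul_def, smul_eq_mul, e3, jumpKernel]
  split_ifs
  · rw [real_inner_smul_left]
    push_cast
    ring
  · ring

lemma integrable_jump_prod (H : HasFourierRep u h) (x : EuclideanSpace ℝ (Fin n)) :
    Integrable (Function.uncurry fun y ξ : EuclideanSpace ℝ (Fin n) =>
      𝐞 (-⟪ξ, x⟫) • (-jumpKernel (-(2 * Real.pi) • ξ) y * h ξ)) (T.jump.prod volume) := by
  have hi : Integrable fun ξ => 3 * (2 * Real.pi) ^ 2 * ((1 + ‖ξ‖ ^ 2) * ‖h ξ‖) := by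
    have := (((H.integrable_moment 0).add (H.integrable_moment 2)).const_mul
      (3 * (2 * Real.pi) ^ 2))
    refine this.congr (Filter.Eventually.of_forall fun ξ => ?_)
    simp only [Pi.add_apply]
    ring
  refine (T.integrable_min.mul_prod hi).mono' ?_ (Filter.Eventually.of_forall fun p => ?_)
  · have h1 : AEStronglyMeasurable (fun p : EuclideanSpace ℝ (Fin n) × EuclideanSpace ℝ (Fin n) =>
        jumpKernel (-(2 * Real.pi) • p.2) p.1) (T.jump.prod volume) :=
      (measurable_jumpKernel.comp (by fun_prop : Measurable fun p : EuclideanSpace ℝ (Fin n) ×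
        EuclideanSpace ℝ (Fin n) => (-(2 * Real.pi) • p.2, p.1))).aestronglyMeasurable
    have h2 : Continuous fun p : EuclideanSpace ℝ (Fin n) × EuclideanSpace ℝ (Fin n) =>
        𝐞 (-⟪p.2, x⟫) := by fun_prop
    exact h2.aestronglyMeasurable.smul (h1.neg.mul H.aestronglyMeasurable.comp_snd)
  · simp only [Function.uncurry]
    rw [Circle.norm_smul, norm_mul, norm_neg]
    have := norm_scaled_le (f := fun ξ => jumpKernel ξ p.1) (C := 3 * min 1 (‖p.1‖ ^ 2))
      (fun ξ => (norm_jumpKernel_le ξ p.1).trans (le_of_eq (by ring))) p.2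
    calc _ ≤ (3 * min 1 (‖p.1‖ ^ 2) * (2 * Real.pi) ^ 2) * (1 + ‖p.2‖ ^ 2) * ‖h p.2‖ := by gcongr
      _ = _ := by ring

lemma jump_integral_eq (H : HasFourierRep u h) (x : EuclideanSpace ℝ (Fin n)) :
    ∫ y, (u (x + y) - u x - (if ‖y‖ < 1 then fderiv ℝ u x y else 0)) ∂T.jump
      = (𝓕 (fun ξ => -T.jumpExponent (-(2 * Real.pi) • ξ) * h ξ) x).re := by
  have hi := integrable_jump_prod (T := T) H x
  simp_rw [jump_integrand_eq H x]
  have h1 : ∫ y, (∫ ξ, 𝐞 (-⟪ξ, x⟫) • (-jumpKernel (-(2 * Real.pi) • ξ) y * h ξ)).re ∂T.jump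
      = (∫ y, (∫ ξ, 𝐞 (-⟪ξ, x⟫) • (-jumpKernel (-(2 * Real.pi) • ξ) y * h ξ)) ∂T.jump).re :=
    Complex.reCLM.integral_comp_comm hi.integral_prod_left
  rw [h1, integral_integral_swap hi, Real.fourier_eq]
  congr 2 with ξ
  rw [jumpExponent]
  simp only [Circle.smul_def, smul_eq_mul]
  rw [integral_const_mul, integral_mul_const, integral_neg]

/-- The Lévy operator acts as the Fourier multiplier with symbol `-T.symbol`. -/
theorem op_eq (H : HasFourierRep u h) (x : EuclideanSpace ℝ (Fin n)) :
    T.op u x = (𝓕 (fun ξ => -T.symbol ξ * h ξ) x).re := by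
  have hJ := H.mul (m := fun ξ => -T.jumpExponent (-(2 * Real.pi) • ξ)) (N := 2)
    ((T.measurable_jumpExponent.comp (by fun_prop)).neg.aestronglyMeasurable)
    (fun ξ => by rw [norm_neg]; exact norm_scaled_le T.norm_jumpExponent_le ξ)
  have hQ : ∀ i, HasFourierRep (fun x => fderiv ℝ (fun z => ∑ j, T.diffusion i j *
      fderiv ℝ u z (EuclideanSpace.single j 1)) x (EuclideanSpace.single i 1)) _ := fun i =>
    (HasFourierRep.sum Finset.univ fun j _ =>
      (H.fderiv (EuclideanSpace.single j 1)).const_mul (T.diffusion i j)).fderiv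
        (EuclideanSpace.single i 1)
  have key := (((H.fderiv T.drift).add ((HasFourierRep.sum Finset.univ fun i _ =>
    hQ i).const_mul (1 / 2))).add hJ).eq_re x
  rw [op, jump_integral_eq H x]
  refine key.trans ?_
  refine congrArg (fun f : EuclideanSpace ℝ (Fin n) → ℂ => (𝓕 f x).re) (funext fun ξ => ?_)
  rw [symbol, exponent_eq, real_inner_smul_right, real_inner_comm]
  simp only [EuclideanSpace.inner_single_right, PiLp.smul_apply, smul_eq_mul]
  push_cast
  -- Two derivatives contribute i² = -1, which turns the diffusion term into minus the quadratic
  -- form at -2πξ.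
  have hS : (∑ i, -(2 * (Real.pi : ℂ) * Complex.I) * (1 * ((starRingEnd ℝ (ξ i) : ℝ) : ℂ)) *
      ∑ j, (T.diffusion i j : ℂ) * (-(2 * (Real.pi : ℂ) * Complex.I) *
        (1 * ((starRingEnd ℝ (ξ j) : ℝ) : ℂ)) * h ξ))
      = -(∑ i, ∑ j, -(2 * (Real.pi : ℂ)) * (ξ i : ℂ) * (T.diffusion i j : ℂ) *
        (-(2 * (Real.pi : ℂ)) * (ξ j : ℂ))) * h ξ := by
    rw [neg_mul, Finset.sum_mul, ← Finset.sum_neg_distrib]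
    refine Finset.sum_congr rfl fun i _ => ?_
    rw [Finset.mul_sum, Finset.sum_mul, ← Finset.sum_neg_distrib]
    refine Finset.sum_congr rfl fun j _ => ?_
    simp only [conj_trivial]
    linear_combination (4 * (Real.pi : ℂ) ^ 2 * (ξ i : ℂ) * (T.diffusion i j : ℂ) * (ξ j : ℂ) * h ξ)
      * Complex.I_sq
  rw [hS]
  ring

end Op

end LevyTriplet

/-! ### Density of test functions in `C₀` -/

section ZeroAtInfty

variable {X : Type*} [TopologicalSpace X]

lemma ZeroAtInftyContinuousMap.abs_apply_le_norm (f : C₀(X, ℝ)) (x : X) : |f x| ≤ ‖f‖ :=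
  f.toBCF.norm_coe_le_norm x

lemma ZeroAtInftyContinuousMap.norm_le_of_abs_le (f : C₀(X, ℝ)) {C : ℝ} (hC : 0 ≤ C)
    (h : ∀ x, |f x| ≤ C) : ‖f‖ ≤ C :=
  (BoundedContinuousFunction.norm_le (f := f.toBCF) hC).2 h

variable {E : Type*} [NormedAddCommGroup E] [NormedSpace ℝ E] [FiniteDimensional ℝ E]

/-- Test functions are dense in `C_∞`. -/
lemma ZeroAtInftyContinuousMap.exists_testFunction_norm_sub_le (φ : C₀(E, ℝ)) {δ : ℝ}
    (hδ : 0 < δ) : ∃ g : C₀(E, ℝ), ContDiff ℝ ((⊤ : ℕ∞) : WithTop ℕ∞) g ∧ HasCompactSupport g ∧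
      ‖φ - g‖ ≤ δ := by
  have : ProperSpace E := FiniteDimensional.proper ℝ E
  -- A smooth g within δ/2 of φ, times a bump χ equal to 1 wherever |φ| > δ/2. The error is (1 - χ)φ
  -- + χ(φ - g).
  obtain ⟨g, hg, hg'⟩ := (ZeroAtInftyContinuousMap.uniformContinuous φ).exists_contDiff_dist_le
    (half_pos hδ)
  obtain ⟨R, hR⟩ := ZeroAtInftyContinuousMapClass.norm_le φ (δ / 2) (half_pos hδ)
  let χ : ContDiffBump (0 : E) := ⟨max R 1, max R 1 + 1, by positivity, by linarith⟩
  have hχs : HasCompactSupport χ := χ.hasCompactSupport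
  have hs : HasCompactSupport fun x => χ x * g x := hχs.mul_right
  have hc : ContDiff ℝ ((⊤ : ℕ∞) : WithTop ℕ∞) fun x => χ x * g x := χ.contDiff.mul hg
  refine ⟨⟨⟨fun x => χ x * g x, hc.continuous⟩, hs.is_zero_at_infty⟩, hc, hs, ?_⟩
  refine ZeroAtInftyContinuousMap.norm_le_of_abs_le _ hδ.le fun x => ?_
  change |φ x - χ x * g x| ≤ δ
  have h1 : |φ x - g x| ≤ δ / 2 := by
    have := hg' x
    rw [dist_comm, Real.dist_eq] at this
    exact this.le
  have h0 := χ.nonneg (x := x)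
  have h0' := χ.le_one (x := x)
  have h2 : |(1 - χ x) * φ x| ≤ δ / 2 := by
    rcases le_or_gt ‖x‖ (max R 1) with hx | hx
    · rw [χ.one_of_mem_closedBall (mem_closedBall_zero_iff.2 hx)]
      simp only [sub_self, zero_mul, abs_zero]
      positivity
    · have := hR x ((le_max_left _ _).trans_lt hx)
      rw [Real.norm_eq_abs] at this
      rw [abs_mul, abs_of_nonneg (by linarith)]
      nlinarith [abs_nonneg (φ x)]
  calc |φ x - χ x * g x| = |(1 - χ x) * φ x + χ x * (φ x - g x)| := by congr 1; ring
    _ ≤ |(1 - χ x) * φ x| + |χ x * (φ x - g x)| := abs_add_le _ _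
    _ ≤ δ / 2 + δ / 2 := by
        gcongr
        rw [abs_mul, abs_of_nonneg h0]
        nlinarith [abs_nonneg (φ x - g x)]
    _ = δ := by ring

end ZeroAtInfty

/-! ### Averages of translates on the Fourier side -/

section Convolution

variable {V : Type*} [NormedAddCommGroup V] [InnerProductSpace ℝ V] [FiniteDimensional ℝ V]
  [MeasurableSpace V] [BorelSpace V] {u : V → ℝ} {h : V → ℂ}

lemma measurable_charFun_scaled (μ : Measure V) [IsFiniteMeasure μ] (c : ℝ) :
    Measurable fun ξ : V => charFun μ (c • ξ) := by
  have : Measurable (charFun μ) := by fun_prop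
  exact this.comp (by fun_prop)

lemma HasFourierRep.abs_le (H : HasFourierRep u h) (x : V) : |u x| ≤ ∫ ξ, ‖h ξ‖ := by
  rw [H.eq_re]
  exact (Complex.abs_re_le_norm _).trans (VectorFourier.norm_fourierIntegral_le_integral_norm ..)

lemma HasFourierRep.integrable_comp_add (H : HasFourierRep u h) (μ : Measure V)
    [IsFiniteMeasure μ] (x : V) : Integrable (fun y => u (x + y)) μ := by
  refine (integrable_const (∫ ξ, ‖h ξ‖)).mono' ?_ (Filter.Eventually.of_forall fun y => H.abs_le _)
  have := H.contDiff.continuous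
  exact (by fun_prop : Continuous fun y => u (x + y)).aestronglyMeasurable

lemma HasFourierRep.integral_add_eq (H : HasFourierRep u h) (μ : Measure V)
    [IsProbabilityMeasure μ] (x : V) :
    ∫ y, u (x + y) ∂μ = (𝓕 (fun ξ => charFun μ (-(2 * Real.pi) • ξ) * h ξ) x).re := by
  have hi : Integrable (Function.uncurry fun y ξ : V => 𝐞 (-⟪ξ, x + y⟫) • h ξ)
      (μ.prod volume) := by
    refine ((integrable_const (1 : ℝ)).mul_prod H.integrable.norm).mono' ?_
      (Filter.Eventually.of_forall fun p => ?_)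
    · have h2 : Continuous fun p : V × V => 𝐞 (-⟪p.2, x + p.1⟫) := by fun_prop
      exact h2.aestronglyMeasurable.smul H.aestronglyMeasurable.comp_snd
    · simp [Function.uncurry, Circle.norm_smul]
  have h1 : ∫ y, u (x + y) ∂μ = ∫ y, (∫ ξ, 𝐞 (-⟪ξ, x + y⟫) • h ξ).re ∂μ := by
    congr 1 with y
    rw [H.eq_re, Real.fourier_eq]
  have h2 : ∫ y, (∫ ξ, 𝐞 (-⟪ξ, x + y⟫) • h ξ).re ∂μ
      = (∫ y, (∫ ξ, 𝐞 (-⟪ξ, x + y⟫) • h ξ) ∂μ).re :=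
    Complex.reCLM.integral_comp_comm hi.integral_prod_left
  rw [h1, h2, integral_integral_swap hi, Real.fourier_eq]
  congr 2 with ξ
  rw [charFun_apply]
  simp only [Circle.smul_def, smul_eq_mul]
  rw [integral_mul_const, ← mul_assoc, ← integral_const_mul]
  congr 2 with y
  rw [Real.fourierChar_apply, Real.fourierChar_apply, ← Complex.exp_add, inner_add_right,
    real_inner_smul_right, real_inner_comm y]
  congr 1
  push_cast
  ring

lemma HasFourierRep.charFun_mul (H : HasFourierRep u h) (μ : Measure V)
    [IsProbabilityMeasure μ] :
    HasFourierRep (fun x => ∫ y, u (x + y) ∂μ)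
      (fun ξ => charFun μ (-(2 * Real.pi) • ξ) * h ξ) := by
  have := H.mul (m := fun ξ => charFun μ (-(2 * Real.pi) • ξ)) (C := 1) (N := 0)
    (measurable_charFun_scaled μ _).aestronglyMeasurable (fun ξ => by
      have := norm_charFun_le_one (μ := μ) (-(2 * Real.pi) • ξ)
      rw [pow_zero]; linarith)
  simpa only [← H.integral_add_eq μ] using this

end Convolution

/-! ### Linearity and the positive maximum principle -/

namespace LevyTriplet

variable {n : ℕ} {T : LevyTriplet n}
  {u v : EuclideanSpace ℝ (Fin n) → ℝ} {h k : EuclideanSpace ℝ (Fin n) → ℂ}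

lemma symbol_mul_rep (T : LevyTriplet n) (H : HasFourierRep u h) :
    HasFourierRep (T.op u) (fun ξ => -T.symbol ξ * h ξ) := by
  obtain ⟨C, hC⟩ := T.exists_norm_symbol_le
  have := H.mul (m := fun ξ => -T.symbol ξ) (N := 2) T.measurable_symbol.neg.aestronglyMeasurable
    (fun ξ => by rw [norm_neg]; exact hC ξ)
  simpa only [← op_eq H] using this

/-- Read off from the multiplier, so the jump integral need not be split. -/
lemma op_add (Hu : HasFourierRep u h) (Hv : HasFourierRep v k) (x : EuclideanSpace ℝ (Fin n)) :
    T.op (fun x => u x + v x) x = T.op u x + T.op v x := by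
  rw [(T.symbol_mul_rep (Hu.add Hv)).eq_re,
    ((T.symbol_mul_rep Hu).add (T.symbol_mul_rep Hv)).eq_re x]
  simp_rw [mul_add]

lemma op_const_mul (Hu : HasFourierRep u h) (c : ℝ) (x : EuclideanSpace ℝ (Fin n)) :
    T.op (fun x => c * u x) x = c * T.op u x := by
  rw [(T.symbol_mul_rep (Hu.const_mul c)).eq_re, ((T.symbol_mul_rep Hu).const_mul c).eq_re x]
  simp_rw [mul_left_comm]

variable (T) in
/-- A family of probability measures whose characteristic functions are `exp (-t ψ)`. -/
def IsSemigroupOf (p : ℝ≥0 → Measure (EuclideanSpace ℝ (Fin n))) : Prop :=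
  (∀ t, IsProbabilityMeasure (p t)) ∧
    ∀ (t : ℝ≥0) ξ, charFun (p t) ξ = Complex.exp (-(t : ℝ) * T.exponent ξ)

/-- The positive maximum principle. -/
lemma op_nonpos_of_forall_le {p : ℝ≥0 → Measure (EuclideanSpace ℝ (Fin n))}
    (hp : T.IsSemigroupOf p) (H : HasFourierRep u h) {x₀ : EuclideanSpace ℝ (Fin n)}
    (hx : ∀ x, u x ≤ u x₀) : T.op u x₀ ≤ 0 := by
  obtain ⟨hp1, hp2⟩ := hp
  have HA := T.symbol_mul_rep H
  have hchar : ∀ t : ℝ, 0 < t → ∀ ξ, charFun (p t.toNNReal) (-(2 * Real.pi) • ξ)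
      = Complex.exp (-t * T.symbol ξ) := fun t ht ξ => by
    rw [hp2, Real.coe_toNNReal _ ht.le]; rfl
  -- A domination uniform in t. If |tψ| ≤ 1, use |eᶻ - 1| ≤ 2|z|; otherwise |e^{-tψ}| ≤ 1, being a
  -- characteristic function, so the difference is at most 2 ≤ 2t|ψ|.
  have hbound : ∀ t : ℝ, 0 < t → ∀ ξ,
      ‖t⁻¹ • (Complex.exp (-t * T.symbol ξ) - 1)‖ ≤ 2 * ‖T.symbol ξ‖ := by
    intro t ht ξ
    have h1 : ‖(-t * T.symbol ξ : ℂ)‖ = t * ‖T.symbol ξ‖ := by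
      rw [norm_mul, norm_neg, Complex.norm_real, Real.norm_of_nonneg ht.le]
    have h2 : ‖Complex.exp (-t * T.symbol ξ) - 1‖ ≤ 2 * (t * ‖T.symbol ξ‖) := by
      rcases le_or_gt ‖(-t * T.symbol ξ : ℂ)‖ 1 with h | h
      · exact (Complex.norm_exp_sub_one_le h).trans (by rw [h1])
      · have h3 : ‖Complex.exp (-t * T.symbol ξ)‖ ≤ 1 := by
          rw [← hchar t ht]; exact norm_charFun_le_one _
        refine (norm_sub_le _ _).trans ?_
        rw [norm_one]
        linarith
    rw [norm_smul, norm_inv, Real.norm_of_nonneg ht.le, inv_mul_le_iff₀ ht]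
    linarith
  -- The integral is the Fourier form of (𝔼 u(x₀ + X_t) - u(x₀))/t, nonpositive because u is maximal
  -- at x₀. Letting t ↓ 0 gives Au(x₀).
  have hquot : ∀ t : ℝ, 0 < t →
      (∫ ξ, 𝐞 (-⟪ξ, x₀⟫) • ((t⁻¹ • (Complex.exp (-t * T.symbol ξ) - 1)) * h ξ)).re ≤ 0 := by
    intro t ht
    have := H.charFun_mul (p t.toNNReal)
    have h1 := (this.add (H.const_mul (-1))).const_mul t⁻¹
    have h2 := h1.eq_re x₀
    rw [Real.fourier_eq] at h2
    have h3 : ∫ y, u (x₀ + y) ∂(p t.toNNReal) ≤ u x₀ := by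
      have hint : Integrable (fun y => u (x₀ + y)) (p t.toNNReal) := by
        have := hp1 t.toNNReal
        exact H.integrable_comp_add _ _
      calc _ ≤ ∫ y, u x₀ ∂(p t.toNNReal) := integral_mono hint (integrable_const _) fun y => hx _
        _ = u x₀ := by simp
    have h4 : t⁻¹ * (∫ y, u (x₀ + y) ∂(p t.toNNReal) + -1 * u x₀) ≤ 0 :=
      mul_nonpos_of_nonneg_of_nonpos (by positivity) (by linarith)
    rw [h2] at h4
    refine (congrArg Complex.re (integral_congr_ae (Filter.Eventually.of_forall
      fun ξ => congrArg (fun z : ℂ => 𝐞 (-⟪ξ, x₀⟫) • z) ?_))).trans_le h4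
    rw [hchar t ht, Complex.real_smul]
    push_cast
    ring
  rw [HA.eq_re, Real.fourier_eq]
  have hlim : Filter.Tendsto (fun t : ℝ =>
      ∫ ξ, 𝐞 (-⟪ξ, x₀⟫) • ((t⁻¹ • (Complex.exp (-t * T.symbol ξ) - 1)) * h ξ)) (𝓝[>] 0)
      (𝓝 (∫ ξ, 𝐞 (-⟪ξ, x₀⟫) • (-T.symbol ξ * h ξ))) := by
    refine tendsto_integral_filter_of_dominated_convergence (fun ξ => 2 * ‖-T.symbol ξ * h ξ‖)
      (Filter.Eventually.of_forall fun t => ?_) ?_ (HA.integrable.norm.const_mul 2)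
      (Filter.Eventually.of_forall fun ξ => ?_)
    · have h2 : Continuous fun ξ : EuclideanSpace ℝ (Fin n) => 𝐞 (-⟪ξ, x₀⟫) := by fun_prop
      have h3 := T.measurable_symbol
      have h4 : Measurable fun ξ => t⁻¹ • (Complex.exp (-t * T.symbol ξ) - 1) := by fun_prop
      exact h2.aestronglyMeasurable.smul (h4.aestronglyMeasurable.mul H.aestronglyMeasurable)
    · filter_upwards [self_mem_nhdsWithin] with t ht
      refine Filter.Eventually.of_forall fun ξ => ?_
      rw [Circle.norm_smul, norm_mul, norm_mul, norm_neg, ← mul_assoc]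
      gcongr
      exact hbound t ht ξ
    · have hd : HasDerivAt (fun t : ℝ => Complex.exp (-(t : ℂ) * T.symbol ξ)) (-T.symbol ξ) 0 := by
        have h1 : HasDerivAt (fun t : ℝ => -(t : ℂ) * T.symbol ξ) (-1 * T.symbol ξ) 0 :=
          (Complex.ofRealCLM.hasDerivAt (x := 0)).neg.mul_const _
        simpa using h1.cexp
      have := hd.tendsto_slope_zero_right
      simp only [zero_add, Complex.ofReal_zero, neg_zero, zero_mul, Complex.exp_zero] at this
      exact (this.mul_const (h ξ)).const_smul _
  refine le_of_tendsto ((Complex.continuous_re.tendsto _).comp hlim) ?_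
  filter_upwards [self_mem_nhdsWithin] with t ht using hquot t ht

end LevyTriplet

/-! ### Dissipativity and closability -/

namespace LevyTriplet

variable {n : ℕ} {T : LevyTriplet n}
  {u v : EuclideanSpace ℝ (Fin n) → ℝ} {h k : EuclideanSpace ℝ (Fin n) → ℂ}

lemma exists_hasFourierRep_of_mem_testGraph
    {q : C₀(EuclideanSpace ℝ (Fin n), ℝ) × C₀(EuclideanSpace ℝ (Fin n), ℝ)}
    (hq : q ∈ T.testGraph) : ∃ h, HasFourierRep q.1 h :=
  hq.2.1.exists_hasFourierRep hq.1

variable (T) in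
/-- The graph of the operator on test functions, as a subspace. -/
def testSubmodule :
    Submodule ℝ (C₀(EuclideanSpace ℝ (Fin n), ℝ) × C₀(EuclideanSpace ℝ (Fin n), ℝ)) where
  carrier := T.testGraph
  add_mem' := by
    intro a b ha hb
    obtain ⟨h, H⟩ := exists_hasFourierRep_of_mem_testGraph ha
    obtain ⟨k, K⟩ := exists_hasFourierRep_of_mem_testGraph hb
    refine ⟨ha.1.add hb.1, ha.2.1.add hb.2.1, fun x => ?_⟩
    change a.2 x + b.2 x = T.op (fun x => a.1 x + b.1 x) x
    rw [op_add H K, ha.2.2, hb.2.2]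
  zero_mem' := by
    refine ⟨contDiff_const (c := (0 : ℝ)), HasCompactSupport.zero, fun x => ?_⟩
    change 0 = T.op (fun _ => 0) x
    simp [op]
  smul_mem' := by
    intro c a ha
    obtain ⟨h, H⟩ := exists_hasFourierRep_of_mem_testGraph ha
    refine ⟨contDiff_const.mul ha.1, ha.2.1.mul_left, fun x => ?_⟩
    change c * a.2 x = T.op (fun x => c * a.1 x) x
    rw [op_const_mul H, ha.2.2]

variable (T) in
/-- The graph of the Lévy operator, as a closed subspace. -/
def graphSubmodule :
    Submodule ℝ (C₀(EuclideanSpace ℝ (Fin n), ℝ) × C₀(EuclideanSpace ℝ (Fin n), ℝ)) :=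
  T.testSubmodule.topologicalClosure

variable (T) in
/-- The image under the Lévy operator of a function with a Fourier representation. -/
def opC₀ (H : HasFourierRep u h) : C₀(EuclideanSpace ℝ (Fin n), ℝ) :=
  ⟨⟨T.op u, (T.symbol_mul_rep H).contDiff.continuous⟩, (T.symbol_mul_rep H).tendsto_zero⟩

variable (T) in
lemma exists_mem_testGraph (g : C₀(EuclideanSpace ℝ (Fin n), ℝ))
    (hg : ContDiff ℝ ((⊤ : ℕ∞) : WithTop ℕ∞) g) (hg' : HasCompactSupport g) :
    ∃ f, (g, f) ∈ T.testGraph := by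
  obtain ⟨h, H⟩ := hg'.exists_hasFourierRep hg
  exact ⟨T.opC₀ H, hg, hg', fun _ => rfl⟩

variable {p : ℝ≥0 → Measure (EuclideanSpace ℝ (Fin n))}

/-- At a maximum point x₀ of u one has Au(x₀) ≤ 0, hence r u(x) ≤ r u(x₀) ≤ (ru - Au)(x₀). -/
lemma mul_apply_le_norm_of_mem_testGraph (hp : T.IsSemigroupOf p)
    {q : C₀(EuclideanSpace ℝ (Fin n), ℝ) × C₀(EuclideanSpace ℝ (Fin n), ℝ)}
    (hq : q ∈ T.testGraph) {r : ℝ} (hr : 0 ≤ r) (x : EuclideanSpace ℝ (Fin n)) :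
    r * q.1 x ≤ ‖r • q.1 - q.2‖ := by
  obtain ⟨h, H⟩ := exists_hasFourierRep_of_mem_testGraph hq
  obtain ⟨x₀, hx₀⟩ := hq.1.continuous.exists_forall_ge_of_hasCompactSupport hq.2.1
  have h1 := op_nonpos_of_forall_le hp H hx₀
  rw [← hq.2.2] at h1
  have h2 := (le_abs_self _).trans ((r • q.1 - q.2).abs_apply_le_norm x₀)
  have h3 : (r • q.1 - q.2) x₀ = r * q.1 x₀ - q.2 x₀ := rfl
  have h4 : r * q.1 x ≤ r * q.1 x₀ := mul_le_mul_of_nonneg_left (hx₀ x) hr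
  linarith

/-- The Lévy operator is dissipative. -/
lemma mul_norm_le_of_mem_graph (hp : T.IsSemigroupOf p)
    {q : C₀(EuclideanSpace ℝ (Fin n), ℝ) × C₀(EuclideanSpace ℝ (Fin n), ℝ)}
    (hq : q ∈ T.graph) {r : ℝ} (hr : 0 < r) :
    r * ‖q.1‖ ≤ ‖r • q.1 - q.2‖ := by
  have hcl : IsClosed {q : C₀(EuclideanSpace ℝ (Fin n), ℝ) × C₀(EuclideanSpace ℝ (Fin n), ℝ) |
      r * ‖q.1‖ ≤ ‖r • q.1 - q.2‖} := isClosed_le (by fun_prop) (by fun_prop)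
  refine closure_minimal (fun q hq => ?_) hcl hq
  have h1 : ‖q.1‖ ≤ r⁻¹ * ‖r • q.1 - q.2‖ := by
    refine ZeroAtInftyContinuousMap.norm_le_of_abs_le _ (by positivity) fun x => ?_
    rw [le_inv_mul_iff₀ hr, abs_eq_max_neg, ← smul_eq_mul]
    rcases max_choice (q.1 x) (-q.1 x) with h | h <;> rw [h]
    · exact mul_apply_le_norm_of_mem_testGraph hp hq hr.le x
    · have := mul_apply_le_norm_of_mem_testGraph hp (T.testSubmodule.neg_mem hq) hr.le x
      have h2 : r • (-q).1 - (-q).2 = -(r • q.1 - q.2) := by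
        ext x
        change r * -q.1 x - -q.2 x = -(r * q.1 x - q.2 x)
        ring
      rwa [h2, norm_neg] at this
  rwa [le_inv_mul_iff₀ hr] at h1

/-- The Lévy operator on test functions is closable. -/
lemma eq_zero_of_zero_mem_graph (hp : T.IsSemigroupOf p)
    {f : C₀(EuclideanSpace ℝ (Fin n), ℝ)} (hf : (0, f) ∈ T.graph) : f = 0 := by
  have key : ∀ g : C₀(EuclideanSpace ℝ (Fin n), ℝ), ContDiff ℝ ((⊤ : ℕ∞) : WithTop ℕ∞) g →
      HasCompactSupport g → ‖g‖ ≤ ‖g - f‖ := by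
    intro g hg hg'
    obtain ⟨a, ha⟩ := T.exists_mem_testGraph g hg hg'
    have ha' : (g, a) ∈ T.graphSubmodule := subset_closure ha
    -- Dissipativity applied to (g, rf + a) and divided by r; the limit r → ∞ removes a.
    have h1 : ∀ r : ℝ, 0 < r → ‖g‖ ≤ ‖g - f - r⁻¹ • a‖ := by
      intro r hr
      have hmem : (r • ((0, f) : C₀(EuclideanSpace ℝ (Fin n), ℝ) × _) + (g, a)) ∈ T.graph :=
        T.graphSubmodule.add_mem (T.graphSubmodule.smul_mem r hf) ha'
      have h2 := mul_norm_le_of_mem_graph hp hmem hr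
      have h3 : r • (r • ((0, f) : C₀(EuclideanSpace ℝ (Fin n), ℝ) × _) + (g, a)).1
          - (r • ((0, f) : C₀(EuclideanSpace ℝ (Fin n), ℝ) × _) + (g, a)).2
          = r • (g - f - r⁻¹ • a) := by
        ext x
        change r * (r * 0 + g x) - (r * f x + a x) = r * (g x - f x - r⁻¹ * a x)
        field_simp
        ring
      rw [h3, norm_smul, Real.norm_of_nonneg hr.le] at h2
      simpa using le_of_mul_le_mul_left h2 hr
    have h4 : Filter.Tendsto (fun r : ℝ => ‖g - f - r⁻¹ • a‖) Filter.atTop (𝓝 ‖g - f‖) := by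
      have := (tendsto_const_nhds (x := g - f)).sub
        (tendsto_inv_atTop_zero.smul_const (f := fun r : ℝ => r⁻¹) a)
      simpa using this.norm
    exact ge_of_tendsto h4 ((Filter.eventually_gt_atTop 0).mono h1)
  refine norm_le_zero_iff.1 (le_of_forall_pos_le_add fun δ hδ => ?_)
  -- With g close to f the inequality ‖g‖ ≤ ‖g - f‖ forces ‖f‖ ≤ 2‖f - g‖ ≤ δ.
  obtain ⟨g, hg, hg', hfg⟩ := f.exists_testFunction_norm_sub_le (half_pos hδ)
  have h1 := key g hg hg'
  rw [norm_sub_rev] at h1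
  have h2 : ‖f‖ ≤ ‖f - g‖ + ‖g‖ := by simpa using norm_add_le (f - g) g
  linarith

end LevyTriplet

/-! ### Smooth truncation with control of derivatives -/

section Cutoff

variable {E : Type*} [NormedAddCommGroup E] [InnerProductSpace ℝ E] [FiniteDimensional ℝ E]

/-- A smooth function whose derivatives vanish at infinity is approximated by its smooth
truncations, together with its first `N` derivatives. -/
lemma exists_cutoff_norm_iteratedFDeriv_le {u : E → ℝ}
    (hu : ContDiff ℝ ((⊤ : ℕ∞) : WithTop ℕ∞) u)
    (hu' : ∀ j, Filter.Tendsto (fun x => ‖iteratedFDeriv ℝ j u x‖) (Filter.cocompact E) (𝓝 0))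
    (N : ℕ) {δ : ℝ} (hδ : 0 < δ) :
    ∃ χ : E → ℝ, ContDiff ℝ ((⊤ : ℕ∞) : WithTop ℕ∞) χ ∧ HasCompactSupport χ ∧
      ∀ j ≤ N, ∀ x, ‖iteratedFDeriv ℝ j (fun x => (1 - χ x) * u x) x‖ ≤ δ := by
  let χ : ContDiffBump (0 : E) := ⟨1, 2, one_pos, one_lt_two⟩
  have hχ : ContDiff ℝ ((⊤ : ℕ∞) : WithTop ℕ∞) χ := χ.contDiff
  have hη : ContDiff ℝ ((⊤ : ℕ∞) : WithTop ℕ∞) fun x => 1 - χ x := contDiff_const.sub hχ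
  have hM : ∀ i, ∃ M, ∀ x, ‖iteratedFDeriv ℝ i (fun x => 1 - χ x) x‖ ≤ M := by
    intro i
    obtain ⟨M, hM⟩ := (χ.hasCompactSupport.iteratedFDeriv (𝕜 := ℝ) i).exists_bound_of_continuous
      (hχ.continuous_iteratedFDeriv (by exact_mod_cast le_top))
    rcases Nat.eq_zero_or_pos i with rfl | hi
    · refine ⟨1, fun x => ?_⟩
      rw [norm_iteratedFDeriv_zero, Real.norm_eq_abs, abs_le]
      constructor <;> linarith [χ.nonneg (x := x), χ.le_one (x := x)]
    · refine ⟨M, fun x => ?_⟩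
      have h1 : (fun x => 1 - χ x) = (fun _ : E => (1 : ℝ)) - (χ : E → ℝ) := rfl
      rw [h1, iteratedFDeriv_sub_apply contDiff_const.contDiffAt
        ((hχ.of_le (by exact_mod_cast le_top)).contDiffAt), iteratedFDeriv_const_of_ne hi.ne']
      simpa using hM x
  choose M hM using hM
  have hM0 : ∀ i, 0 ≤ M i := fun i => (norm_nonneg _).trans (hM i 0)
  -- Dominates the Leibniz constants of every order up to N at once; the summand 1 makes it
  -- positive.
  let K : ℝ := 1 + ∑ j ∈ Finset.range (N + 1), ∑ i ∈ Finset.range (j + 1), (j.choose i : ℝ) * M i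
  have hK : 0 < K := by
    have : 0 ≤ ∑ j ∈ Finset.range (N + 1), ∑ i ∈ Finset.range (j + 1), (j.choose i : ℝ) * M i :=
      Finset.sum_nonneg fun j _ => Finset.sum_nonneg fun i _ => mul_nonneg (by positivity) (hM0 i)
    positivity
  have hsmall : ∀ᶠ x in Filter.cocompact E, ∀ j ∈ Finset.range (N + 1),
      ‖iteratedFDeriv ℝ j u x‖ < δ / K := by
    rw [Filter.eventually_all_finset]
    exact fun j _ => (hu' j).eventually_lt_const (by positivity)
  obtain ⟨R, hR⟩ := Metric.closedBall_compl_subset_of_mem_cocompact hsmall 0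
  -- Dilation by c ≤ 1 does not increase the derivative bounds `M`. It also puts |x| ≤ R strictly
  -- inside the plateau of the bump, so there all derivatives of 1 - χ(c x) vanish; outside, those
  -- of u are small.
  let c : ℝ := (max R 1 + 1)⁻¹
  have hc0 : 0 < c := by positivity
  have hc1 : c ≤ 1 := inv_le_one_of_one_le₀ (by linarith [le_max_right R 1])
  have hcR : ∀ x : E, ‖x‖ ≤ R → ‖c • x‖ < 1 := by
    intro x hx
    rw [norm_smul, Real.norm_of_nonneg hc0.le, inv_mul_lt_iff₀ (by positivity)]
    linarith [le_max_left R 1]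
  have hχc : ContDiff ℝ ((⊤ : ℕ∞) : WithTop ℕ∞) fun x : E => χ (c • x) :=
    hχ.comp (contDiff_const_smul c)
  have hηc : ContDiff ℝ ((⊤ : ℕ∞) : WithTop ℕ∞) fun x : E => 1 - χ (c • x) :=
    contDiff_const.sub hχc
  have hηM : ∀ i x, ‖iteratedFDeriv ℝ i (fun x => 1 - χ (c • x)) x‖ ≤ M i := by
    intro i x
    rw [iteratedFDeriv_comp_const_smul (f := fun x => 1 - χ x) c
      (hη.of_le (by exact_mod_cast le_top)), norm_smul, norm_pow, Real.norm_of_nonneg hc0.le]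
    calc c ^ i * _ ≤ 1 * M i := by
          gcongr
          · exact pow_le_one₀ hc0.le hc1
          · exact hM _ _
      _ = M i := one_mul _
  have hη0 : ∀ i x, ‖x‖ ≤ R → iteratedFDeriv ℝ i (fun x => 1 - χ (c • x)) x = 0 := by
    intro i x hx
    have h1 : (fun x : E => 1 - χ (c • x)) =ᶠ[𝓝 x] fun _ => 0 := by
      have : ∀ᶠ z in 𝓝 x, ‖c • z‖ < 1 :=
        (by fun_prop : Continuous fun z : E => ‖c • z‖).continuousAt.eventually_lt_const (hcR x hx)
      filter_upwards [this] with z hz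
      rw [χ.one_of_mem_closedBall (mem_closedBall_zero_iff.2 hz.le), sub_self]
    rw [(h1.iteratedFDeriv ℝ i).eq_of_nhds]
    simp
  refine ⟨fun x => χ (c • x), hχc, ?_, fun j hj x => ?_⟩
  · exact χ.hasCompactSupport.comp_homeomorph (Homeomorph.smulOfNeZero c hc0.ne')
  · refine (norm_iteratedFDeriv_mul_le hηc hu x (by exact_mod_cast le_top)).trans ?_
    have hterm : ∀ i ∈ Finset.range (j + 1), (j.choose i : ℝ) *
        ‖iteratedFDeriv ℝ i (fun x => 1 - χ (c • x)) x‖ * ‖iteratedFDeriv ℝ (j - i) u x‖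
        ≤ (j.choose i : ℝ) * M i * (δ / K) := by
      intro i hi
      rcases le_or_gt ‖x‖ R with hx | hx
      · rw [hη0 i x hx, norm_zero, mul_zero, zero_mul]
        have := hM0 i
        positivity
      · have h1 : ‖iteratedFDeriv ℝ (j - i) u x‖ ≤ δ / K := by
          have h2 := hR (show x ∈ (Metric.closedBall 0 R)ᶜ by simpa using hx)
          exact (h2 (j - i) (Finset.mem_range.2 (by omega))).le
        have := hM0 i
        gcongr
        exact hηM i x
    refine (Finset.sum_le_sum hterm).trans ?_
    rw [← Finset.sum_mul, mul_div_assoc', div_le_iff₀ hK, mul_comm]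
    gcongr
    have := Finset.single_le_sum (s := Finset.range (N + 1))
      (f := fun j => ∑ i ∈ Finset.range (j + 1), (j.choose i : ℝ) * M i)
      (fun j _ => Finset.sum_nonneg fun i _ => mul_nonneg (by positivity) (hM0 i))
      (Finset.mem_range.2 (Nat.lt_succ_of_le hj))
    simp only [K]
    linarith

end Cutoff

/-! ### Functions with a Fourier representation lie in the domain -/

namespace LevyTriplet

variable {n : ℕ} (T : LevyTriplet n)

/-- The Lévy operator is bounded from `C²` to the bounded functions. -/
lemma exists_abs_op_le : ∃ C, 0 < C ∧ ∀ (v : EuclideanSpace ℝ (Fin n) → ℝ) (c : ℝ),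
    ContDiff ℝ 2 v → (∀ j ≤ 2, ∀ x, ‖iteratedFDeriv ℝ j v x‖ ≤ c) → ∀ x, |T.op v x| ≤ C * c := by
  let S : ℝ := ∑ i, ∑ j, |T.diffusion i j|
  let J : ℝ := ∫ y, min 1 (‖y‖ ^ 2) ∂T.jump
  have hS : 0 ≤ S := by positivity
  have hJ : 0 ≤ J := integral_nonneg fun y => by positivity
  refine ⟨1 + ‖T.drift‖ + S + 2 * J, by positivity, fun v c hv hc x => ?_⟩
  have hc0 : 0 ≤ c := (norm_nonneg _).trans (hc 0 (by norm_num) x)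
  have b0 : ∀ x, |v x| ≤ c := fun x => by simpa using hc 0 (by norm_num) x
  have b1 : ∀ x, ‖fderiv ℝ v x‖ ≤ c := fun x => by simpa using hc 1 (by norm_num) x
  have b2 : ∀ x, ‖fderiv ℝ (fderiv ℝ v) x‖ ≤ c := fun x => by
    rw [← norm_iteratedFDeriv_one, norm_iteratedFDeriv_fderiv]; exact hc 2 le_rfl x
  have hv1 : ContDiff ℝ 1 (fderiv ℝ v) := hv.fderiv_right (by norm_num)
  have hd1 : Differentiable ℝ v := hv.differentiable (by norm_num)
  have hd2 : Differentiable ℝ (fderiv ℝ v) := hv1.differentiable (by norm_num)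
  have e1 : |fderiv ℝ v x T.drift| ≤ ‖T.drift‖ * c := by
    refine ((fderiv ℝ v x).le_opNorm T.drift).trans ?_
    rw [mul_comm]
    gcongr
    exact b1 x
  have e2 : |(1 / 2) * ∑ i, fderiv ℝ
        (fun z => ∑ j, T.diffusion i j * fderiv ℝ v z (EuclideanSpace.single j 1)) x
        (EuclideanSpace.single i 1)| ≤ S * c := by
    have h1 : ∀ i, fderiv ℝ
        (fun z => ∑ j, T.diffusion i j * fderiv ℝ v z (EuclideanSpace.single j 1)) x
        (EuclideanSpace.single i 1) = ∑ j, T.diffusion i j *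
          fderiv ℝ (fderiv ℝ v) x (EuclideanSpace.single i 1) (EuclideanSpace.single j 1) := by
      intro i
      have hd : ∀ j, HasFDerivAt (fun z => T.diffusion i j *
          fderiv ℝ v z (EuclideanSpace.single j 1)) _ x := fun j =>
        (((hd2 x).hasFDerivAt).clm_apply (hasFDerivAt_const (EuclideanSpace.single j (1 : ℝ)) x)
          ).const_mul (T.diffusion i j)
      rw [(HasFDerivAt.fun_sum fun j _ => hd j).fderiv]
      simp
    simp_rw [h1]
    rw [abs_mul, abs_of_pos (by norm_num : (0 : ℝ) < 1 / 2)]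
    have h2 : |∑ i, ∑ j, T.diffusion i j * fderiv ℝ (fderiv ℝ v) x
        (EuclideanSpace.single i 1) (EuclideanSpace.single j 1)| ≤ S * c := by
      simp only [S, Finset.sum_mul]
      refine (Finset.abs_sum_le_sum_abs _ _).trans (Finset.sum_le_sum fun i _ => ?_)
      refine (Finset.abs_sum_le_sum_abs _ _).trans (Finset.sum_le_sum fun j _ => ?_)
      rw [abs_mul]
      gcongr
      have := (fderiv ℝ (fderiv ℝ v) x).le_opNorm₂ (EuclideanSpace.single i 1)
        (EuclideanSpace.single j 1)
      simp only [PiLp.norm_single, norm_one, mul_one] at this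
      exact this.trans (b2 x)
    have := abs_nonneg (∑ i, ∑ j, T.diffusion i j * fderiv ℝ (fderiv ℝ v) x
        (EuclideanSpace.single i 1) (EuclideanSpace.single j 1))
    linarith
  have e3 : |∫ y, (v (x + y) - v x - (if ‖y‖ < 1 then fderiv ℝ v x y else 0)) ∂T.jump|
      ≤ (2 * J) * c := by
    -- For |y| < 1 the gradient is c-Lipschitz, so the first-order Taylor remainder is at most
    -- c|y|²; otherwise 2c bounds the increment.
    have h1 : ∀ y, ‖v (x + y) - v x - (if ‖y‖ < 1 then fderiv ℝ v x y else 0)‖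
        ≤ (2 * c) * min 1 (‖y‖ ^ 2) := by
      intro y
      split_ifs with hy
      · have h1 : ‖y‖ ^ 2 ≤ 1 := by nlinarith [norm_nonneg y]
        rw [min_eq_right h1]
        have hx : x ∈ Metric.closedBall x ‖y‖ := Metric.mem_closedBall_self (norm_nonneg _)
        have hxy : x + y ∈ Metric.closedBall x ‖y‖ := by simp
        have h2 : ∀ z ∈ Metric.closedBall x ‖y‖, ‖fderiv ℝ v z - fderiv ℝ v x‖ ≤ c * ‖y‖ := by
          intro z hz
          refine ((convex_closedBall x ‖y‖).norm_image_sub_le_of_norm_fderiv_le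
            (fun z _ => hd2 z) (fun z _ => b2 z) hx hz).trans ?_
          gcongr
          simpa [dist_eq_norm] using hz
        have h3 := (convex_closedBall x ‖y‖).norm_image_sub_le_of_norm_fderiv_le'
          (fun z _ => hd1 z) h2 hx hxy
        simp only [add_sub_cancel_left] at h3
        refine h3.trans ?_
        nlinarith [sq_nonneg ‖y‖]
      · have h1 : 1 ≤ ‖y‖ ^ 2 := by nlinarith [norm_nonneg y]
        rw [min_eq_left h1, sub_zero]
        refine (norm_sub_le _ _).trans ?_
        have := b0 (x + y)
        have := b0 x
        simp only [Real.norm_eq_abs]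
        linarith
    refine (norm_integral_le_of_norm_le (T.integrable_min.const_mul (2 * c))
      (Filter.Eventually.of_forall h1)).trans (le_of_eq ?_)
    rw [integral_const_mul]
    ring
  rw [op]
  calc _ ≤ _ := (abs_add_le _ _).trans (add_le_add_left (abs_add_le _ _) _)
    _ ≤ ‖T.drift‖ * c + S * c + (2 * J) * c := add_le_add (add_le_add e1 e2) e3
    _ ≤ _ := by nlinarith

variable {T} {u : EuclideanSpace ℝ (Fin n) → ℝ} {h : EuclideanSpace ℝ (Fin n) → ℂ}

/-- Functions with a Fourier representation are in the domain of the Lévy operator. -/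
lemma mem_graph_of_hasFourierRep {g : C₀(EuclideanSpace ℝ (Fin n), ℝ)}
    (H : HasFourierRep g h) : (g, T.opC₀ H) ∈ T.graph := by
  obtain ⟨C, hC, hop⟩ := T.exists_abs_op_le
  refine Metric.mem_closure_iff.2 fun δ hδ => ?_
  -- The error (1 - χ)g is small in C², so both it and its image under the operator are uniformly
  -- small; the factor 1 + C covers both components.
  obtain ⟨χ, hχ, hχ', hb⟩ := exists_cutoff_norm_iteratedFDeriv_le H.contDiff
    H.tendsto_iteratedFDeriv 2 (δ := δ / (2 * (1 + C))) (by positivity)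
  have hs : HasCompactSupport fun x => χ x * g x := hχ'.mul_right
  have hc : ContDiff ℝ ((⊤ : ℕ∞) : WithTop ℕ∞) fun x => χ x * g x := hχ.mul H.contDiff
  obtain ⟨k, K⟩ := hs.exists_hasFourierRep hc
  let w : C₀(EuclideanSpace ℝ (Fin n), ℝ) :=
    ⟨⟨fun x => χ x * g x, hc.continuous⟩, hs.is_zero_at_infty⟩
  have hδ' : (1 + C) * (δ / (2 * (1 + C))) = δ / 2 := by field_simp
  have hpos : 0 < δ / (2 * (1 + C)) := by positivity
  refine ⟨(w, T.opC₀ K), ⟨hc, hs, fun _ => rfl⟩, ?_⟩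
  rw [dist_eq_norm, Prod.mk_sub_mk, Prod.norm_mk, max_lt_iff]
  constructor
  · refine lt_of_le_of_lt (ZeroAtInftyContinuousMap.norm_le_of_abs_le _ (half_pos hδ).le
      fun x => ?_) (half_lt_self hδ)
    have := hb 0 (by norm_num) x
    rw [norm_iteratedFDeriv_zero, Real.norm_eq_abs] at this
    have e : (g - w) x = (1 - χ x) * g x := by
      change g x - χ x * g x = _
      ring
    rw [e]
    nlinarith
  · refine lt_of_le_of_lt (ZeroAtInftyContinuousMap.norm_le_of_abs_le _ (half_pos hδ).le
      fun x => ?_) (half_lt_self hδ)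
    have e : (fun x => (1 - χ x) * g x) = fun x => g x + (-1) * (χ x * g x) := by
      ext x; ring
    have h1 := hop (fun x => (1 - χ x) * g x) _
      (((contDiff_const.sub hχ).mul H.contDiff).of_le (WithTop.coe_le_coe.2 le_top)) hb x
    rw [e, op_add H (K.const_mul (-1)), op_const_mul K] at h1
    have e2 : (T.opC₀ H - T.opC₀ K) x = T.op g x + -1 * T.op (fun x => χ x * g x) x := by
      change T.op g x - T.op (fun x => χ x * g x) x = _
      ring
    rw [e2]
    nlinarith

end LevyTriplet

/-! ### Averages of translates as contractions of `C₀` -/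

section Average

lemma ZeroAtInftyContinuousMap.integrable_comp_add {E : Type*} [NormedAddCommGroup E]
    [SecondCountableTopology E] [MeasurableSpace E] [BorelSpace E] (φ : C₀(E, ℝ)) (μ : Measure E)
    [IsFiniteMeasure μ] (x : E) : Integrable (fun y => φ (x + y)) μ := by
  refine (integrable_const ‖φ‖).mono' ?_
    (Filter.Eventually.of_forall fun y => φ.abs_apply_le_norm _)
  exact ((map_continuous φ).comp (continuous_const.add continuous_id)).aestronglyMeasurable

variable {E : Type*} [NormedAddCommGroup E] [NormedSpace ℝ E] [FiniteDimensional ℝ E]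
  [MeasurableSpace E] [BorelSpace E]

/-- The average `x ↦ ∫ φ (x + y) μ(dy)` of a function vanishing at infinity. -/
def ZeroAtInftyContinuousMap.translateAverage (μ : Measure E) [IsProbabilityMeasure μ] (φ : C₀(E, ℝ)) :
    C₀(E, ℝ) where
  toFun x := ∫ y, φ (x + y) ∂μ
  continuous_toFun := by
    refine continuous_of_dominated (bound := fun _ => ‖φ‖)
      (fun x => (φ.integrable_comp_add μ x).aestronglyMeasurable)
      (fun x => Filter.Eventually.of_forall fun y => φ.abs_apply_le_norm _) (integrable_const _)
      (Filter.Eventually.of_forall fun y => ?_)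
    exact (map_continuous φ).comp (continuous_id.add continuous_const)
  zero_at_infty' := by
    have : ProperSpace E := FiniteDimensional.proper ℝ E
    -- Dominated convergence along a filter requires countable generation.
    have : (Filter.cocompact E).IsCountablyGenerated := by
      rw [← Metric.cobounded_eq_cocompact, ← comap_norm_atTop]
      infer_instance
    have := tendsto_integral_filter_of_dominated_convergence (μ := μ) (l := Filter.cocompact E)
      (F := fun x y => φ (x + y)) (f := fun _ => 0) (fun _ => ‖φ‖)
      (Filter.Eventually.of_forall fun x => (φ.integrable_comp_add μ x).aestronglyMeasurable)
      (Filter.Eventually.of_forall fun x => Filter.Eventually.of_forall fun y =>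
        φ.abs_apply_le_norm _) (integrable_const _)
      (Filter.Eventually.of_forall fun y => (zero_at_infty φ).comp
        (Homeomorph.addRight y).isClosedEmbedding.tendsto_cocompact)
    simpa using this

namespace ZeroAtInftyContinuousMap

variable (μ : Measure E) [IsProbabilityMeasure μ] (φ g : C₀(E, ℝ))

lemma translateAverage_apply (x : E) : translateAverage μ φ x = ∫ y, φ (x + y) ∂μ := rfl

lemma translateAverage_sub : translateAverage μ (φ - g) = translateAverage μ φ - translateAverage μ g := by
  ext x
  change _ = translateAverage μ φ x - translateAverage μ g x
  rw [translateAverage_apply, translateAverage_apply, translateAverage_apply,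
    ← integral_sub (φ.integrable_comp_add μ x) (g.integrable_comp_add μ x)]
  rfl

lemma norm_translateAverage_le : ‖translateAverage μ φ‖ ≤ ‖φ‖ := by
  refine norm_le_of_abs_le _ (norm_nonneg _) fun x => ?_
  rw [translateAverage_apply]
  refine (norm_integral_le_of_norm_le (f := fun y => φ (x + y)) (integrable_const ‖φ‖)
    (Filter.Eventually.of_forall fun y => φ.abs_apply_le_norm (x + y))).trans ?_
  simp

end ZeroAtInftyContinuousMap

end Average

/-! ### The resolvent equation and unique continuation -/

namespace LevyTriplet

open ZeroAtInftyContinuousMap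

variable {n : ℕ} {T : LevyTriplet n} {μ : Measure (EuclideanSpace ℝ (Fin n))}
  [IsProbabilityMeasure μ] {r : ℝ}

/-- The resolvent maps `C_∞` into the domain of the Lévy operator. -/
lemma translateAverage_mem_graph (hr : 0 < r) (hμ : ∀ ξ, charFun μ ξ * (r + T.exponent ξ) = r)
    (φ : C₀(EuclideanSpace ℝ (Fin n), ℝ)) :
    (translateAverage μ φ, r • (translateAverage μ φ - φ)) ∈ T.graph := by
  have test : ∀ g : C₀(EuclideanSpace ℝ (Fin n), ℝ), ContDiff ℝ ((⊤ : ℕ∞) : WithTop ℕ∞) g →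
      HasCompactSupport g → (translateAverage μ g, r • (translateAverage μ g - g)) ∈ T.graph := by
    intro g hg hg'
    obtain ⟨h, H⟩ := hg'.exists_hasFourierRep hg
    have K : HasFourierRep (translateAverage μ g) _ := H.charFun_mul μ
    convert mem_graph_of_hasFourierRep (T := T) K using 2
    ext x
    change r * (translateAverage μ g x - g x) = T.op (translateAverage μ g) x
    have h1 := ((K.add (H.const_mul (-1))).const_mul r).eq_re x
    rw [(T.symbol_mul_rep K).eq_re]
    have h2 : r * (translateAverage μ g x - g x) = r * (translateAverage μ g x + -1 * g x) := by ring
    rw [h2, h1]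
    refine congrArg (fun f : EuclideanSpace ℝ (Fin n) → ℂ => (𝓕 f x).re) (funext fun ξ => ?_)
    have h3 := hμ (-(2 * Real.pi) • ξ)
    rw [symbol]
    push_cast
    -- With χ = r/(r + ψ), the resolvent equation is r(χ - 1) = -ψχ.
    linear_combination h ξ * h3
  have hcl : IsClosed T.graph := isClosed_closure
  rw [← hcl.closure_eq]
  refine Metric.mem_closure_iff.2 fun δ hδ => ?_
  -- Averaging is a contraction, so the two components move by at most 1 and 2r times ‖φ - g‖; hence
  -- the constant 1 + 2r.
  obtain ⟨g, hg, hg', hφg⟩ := φ.exists_testFunction_norm_sub_le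
    (δ := δ / (2 * (1 + 2 * r))) (by positivity)
  refine ⟨_, test g hg hg', ?_⟩
  have hδ' : (1 + 2 * r) * (δ / (2 * (1 + 2 * r))) = δ / 2 := by field_simp
  have hpos : 0 < δ / (2 * (1 + 2 * r)) := by positivity
  have h1 : ‖translateAverage μ φ - translateAverage μ g‖ ≤ δ / (2 * (1 + 2 * r)) := by
    rw [← translateAverage_sub]
    exact (norm_translateAverage_le _ _).trans hφg
  rw [dist_eq_norm, Prod.mk_sub_mk, Prod.norm_mk, max_lt_iff]
  constructor
  · nlinarith
  · have h2 : r • (translateAverage μ φ - φ) - r • (translateAverage μ g - g)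
        = r • ((translateAverage μ φ - translateAverage μ g) - (φ - g)) := by
      ext x
      change r * (translateAverage μ φ x - φ x) - r * (translateAverage μ g x - g x)
        = r * ((translateAverage μ φ x - translateAverage μ g x) - (φ x - g x))
      ring
    rw [h2, norm_smul, Real.norm_of_nonneg hr.le]
    have h3 := norm_sub_le (translateAverage μ φ - translateAverage μ g) (φ - g)
    nlinarith

/-- Under the unique continuation principle, a function in `C_∞` vanishes if both it and its
resolvent vanish on a non-empty open set. -/
theorem UniqueContinuation.eq_zero_of_integral_eq_zero (hT : T.UniqueContinuation)
    {p : ℝ≥0 → Measure (EuclideanSpace ℝ (Fin n))} (hp : T.IsSemigroupOf p) (hr : 0 < r)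
    (hμ : ∀ ξ, charFun μ ξ * (r + T.exponent ξ) = r) {G : Set (EuclideanSpace ℝ (Fin n))}
    (hG : IsOpen G) (hG' : G.Nonempty) {φ : C₀(EuclideanSpace ℝ (Fin n), ℝ)}
    (h0 : ∀ x ∈ G, φ x = 0) (h1 : ∀ x ∈ G, ∫ y, φ (x + y) ∂μ = 0) : φ = 0 := by
  have hmem := translateAverage_mem_graph hr hμ φ
  have hu : translateAverage μ φ = 0 := by
    refine hT G hG hG' _ _ hmem (fun x hx => ?_) h1
    change r * (translateAverage μ φ x - φ x) = 0
    rw [translateAverage_apply, h1 x hx, h0 x hx, sub_zero, mul_zero]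
  rw [hu] at hmem
  have h2 := eq_zero_of_zero_mem_graph hp hmem
  ext x
  have h3 : r * (0 - φ x) = 0 := congrArg (fun g : C₀(EuclideanSpace ℝ (Fin n), ℝ) => g x) h2
  simpa [hr.ne'] using h3

end LevyTriplet

/-! ### Evaluation at an independent random time -/

section RoundUp

/-- The smallest multiple of `1 / (k + 1)` which is larger than `t`. -/
def NNReal.roundUp (k : ℕ) (t : ℝ≥0) : ℝ≥0 := ((⌊((k : ℝ≥0) + 1) * t⌋₊ : ℝ≥0) + 1) / (k + 1)

/-- Strictness matters twice: paths are continuous along `Set.Ioi t`, and rounded times are positive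
even when t = 0. -/
lemma NNReal.lt_roundUp (k : ℕ) (t : ℝ≥0) : t < NNReal.roundUp k t := by
  rw [roundUp, lt_div_iff₀ (by positivity), mul_comm]
  exact Nat.lt_floor_add_one _

lemma NNReal.roundUp_le (k : ℕ) (t : ℝ≥0) : NNReal.roundUp k t ≤ t + 1 / (k + 1) := by
  rw [roundUp, add_div]
  gcongr
  rw [div_le_iff₀ (by positivity), mul_comm]
  exact Nat.floor_le (by positivity)

lemma NNReal.tendsto_roundUp (t : ℝ≥0) :
    Filter.Tendsto (fun k => NNReal.roundUp k t) Filter.atTop (𝓝[>] t) := by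
  refine tendsto_nhdsWithin_iff.2 ⟨?_, Filter.Eventually.of_forall fun k => lt_roundUp k t⟩
  refine tendsto_of_tendsto_of_tendsto_of_le_of_le tendsto_const_nhds ?_
    (fun k => (lt_roundUp k t).le) (fun k => roundUp_le k t)
  have := (tendsto_const_nhds (x := t)).add (tendsto_one_div_add_atTop_nhds_zero_nat (𝕜 := ℝ≥0))
  simpa using this

end RoundUp

section IndependentTime

variable {Ω : Type*} [MeasurableSpace Ω] {P : Measure Ω} {E : Type*} {X : ℝ≥0 → Ω → E} {τ : Ω → ℝ≥0}

lemma tendsto_eval_roundUp [TopologicalSpace E]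
    (hr : ∀ᵐ ω ∂P, ∀ t, ContinuousWithinAt (fun s => X s ω) (Set.Ioi t) t) :
    ∀ᵐ ω ∂P, Filter.Tendsto (fun k => X (NNReal.roundUp k (τ ω)) ω) Filter.atTop
      (𝓝 (X (τ ω) ω)) := by
  filter_upwards [hr] with ω hω
  exact (hω (τ ω)).tendsto.comp (NNReal.tendsto_roundUp (τ ω))

variable [MeasurableSpace E]

/-- The rounded time takes countably many values, so measurability of each `X t` suffices and no
joint measurability is needed. -/
lemma measurable_eval_roundUp (hX : ∀ t, Measurable (X t)) (hτ : Measurable τ) (k : ℕ) :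
    Measurable fun ω => X (NNReal.roundUp k (τ ω)) ω := by
  have h1 : Measurable fun q : ℕ × Ω => X (((q.1 : ℝ≥0) + 1) / (k + 1)) q.2 :=
    measurable_from_prod_countable_right fun m => hX (((m : ℝ≥0) + 1) / (k + 1))
  exact h1.comp (f := fun ω => (⌊((k : ℝ≥0) + 1) * τ ω⌋₊, ω)) (by fun_prop)

lemma aemeasurable_eval_time [TopologicalSpace E] [TopologicalSpace.PseudoMetrizableSpace E] [BorelSpace E]
    (hX : ∀ t, Measurable (X t)) (hτ : Measurable τ)
    (hr : ∀ᵐ ω ∂P, ∀ t, ContinuousWithinAt (fun s => X s ω) (Set.Ioi t) t) :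
    AEMeasurable (fun ω => X (τ ω) ω) P :=
  aemeasurable_of_tendsto_metrizable_ae Filter.atTop
    (fun k => (measurable_eval_roundUp hX hτ k).aemeasurable) (tendsto_eval_roundUp hr)

variable [IsProbabilityMeasure P] {F : Type*} [NormedAddCommGroup F] [NormedSpace ℝ F] [MeasurableSpace F] [BorelSpace F]
  [SecondCountableTopology F] {f : E → F} {C : ℝ}

/-- The rounded time factors through a natural number independent of the path. Evaluation is
measurable on ℕ times path space, where Fubini applies. -/
lemma integral_eval_roundUp (hX : ∀ t, Measurable (X t)) (hτ : Measurable τ)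
    (hind : IndepFun τ (fun ω t => X t ω) P) (hf : Measurable f) (hC : ∀ x, ‖f x‖ ≤ C) (k : ℕ) :
    ∫ ω, f (X (NNReal.roundUp k (τ ω)) ω) ∂P
      = ∫ ω, (∫ ω', f (X (NNReal.roundUp k (τ ω)) ω') ∂P) ∂P := by
  let N : Ω → ℕ := fun ω => ⌊((k : ℝ≥0) + 1) * τ ω⌋₊
  let s : ℕ → ℝ≥0 := fun m => ((m : ℝ≥0) + 1) / (k + 1)
  have hN : Measurable N := by fun_prop
  have hpath : Measurable fun ω t => X t ω := measurable_pi_lambda _ hX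
  have hi : IndepFun N (fun ω t => X t ω) P :=
    hind.comp (φ := fun t : ℝ≥0 => ⌊((k : ℝ≥0) + 1) * t⌋₊) (by fun_prop) measurable_id
  have hmap := (indepFun_iff_map_prod_eq_prod_map_map hN.aemeasurable hpath.aemeasurable).1 hi
  let G : ℕ × (ℝ≥0 → E) → F := fun q => f (q.2 (s q.1))
  have hG : Measurable G := measurable_from_prod_countable_right fun m =>
    hf.comp (measurable_pi_apply (s m))
  have hprob1 : IsProbabilityMeasure (P.map N) := Measure.isProbabilityMeasure_map hN.aemeasurable
  have hprob2 : IsProbabilityMeasure (P.map fun ω t => X t ω) :=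
    Measure.isProbabilityMeasure_map hpath.aemeasurable
  have hGi : Integrable G ((P.map N).prod (P.map fun ω t => X t ω)) :=
    (integrable_const C).mono' hG.aestronglyMeasurable (Filter.Eventually.of_forall fun q => hC _)
  calc ∫ ω, f (X (NNReal.roundUp k (τ ω)) ω) ∂P
      = ∫ q, G q ∂(P.map fun ω => (N ω, fun t => X t ω)) := by
        rw [integral_map (by fun_prop) hG.aestronglyMeasurable]
        rfl
    _ = ∫ m, (∫ w, G (m, w) ∂(P.map fun ω t => X t ω)) ∂(P.map N) := by
        rw [hmap, integral_prod _ hGi]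
    _ = ∫ m, (∫ ω', f (X (s m) ω') ∂P) ∂(P.map N) := by
        refine integral_congr_ae (Filter.Eventually.of_forall fun m => ?_)
        exact integral_map hpath.aemeasurable
          (hf.comp (measurable_pi_apply (s m))).aestronglyMeasurable
    _ = _ := by
        rw [integral_map hN.aemeasurable
          (by exact (measurable_of_countable _).aestronglyMeasurable)]
        rfl

/-- The expectation of `f (X_τ)` at an independent time `τ` as a limit of expectations of
`f (X_t)` at discretizations of `τ`. -/
lemma tendsto_integral_eval_roundUp [TopologicalSpace E] [OpensMeasurableSpace E]
    (hX : ∀ t, Measurable (X t)) (hτ : Measurable τ)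
    (hr : ∀ᵐ ω ∂P, ∀ t, ContinuousWithinAt (fun s => X s ω) (Set.Ioi t) t)
    (hind : IndepFun τ (fun ω t => X t ω) P) (hf : Continuous f) (hC : ∀ x, ‖f x‖ ≤ C) :
    Filter.Tendsto (fun k => ∫ ω, (∫ ω', f (X (NNReal.roundUp k (τ ω)) ω') ∂P) ∂P) Filter.atTop
      (𝓝 (∫ ω, f (X (τ ω) ω) ∂P)) := by
  simp_rw [← integral_eval_roundUp hX hτ hind hf.measurable hC]
  refine tendsto_integral_of_dominated_convergence (fun _ => C) (fun k => ?_) (integrable_const C)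
    (fun k => Filter.Eventually.of_forall fun ω => hC _) ?_
  · exact (hf.measurable.comp (measurable_eval_roundUp hX hτ k)).aestronglyMeasurable
  · filter_upwards [tendsto_eval_roundUp (τ := τ) hr] with ω hω
    exact (hf.tendsto _).comp hω

end IndependentTime

/-- The Laplace transform of the exponential distribution. -/
lemma integral_cexp_neg_mul_expMeasure {r : ℝ} (hr : 0 < r) {z : ℂ} (hz : 0 ≤ z.re) :
    ∫ t : ℝ, Complex.exp (-t * z) ∂(expMeasure r) = r / (r + z) := by
  have h1 : expMeasure r = volume.withDensity (exponentialPDF r) := rfl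
  have hm : Measurable (exponentialPDF r) := (measurable_exponentialPDFReal r).ennreal_ofReal
  rw [h1, integral_withDensity_eq_integral_toReal_smul hm
    (Filter.Eventually.of_forall fun _ => ENNReal.ofReal_lt_top)]
  have h2 : (fun t : ℝ => (exponentialPDF r t).toReal • Complex.exp (-t * z))
      =ᵐ[volume] (Set.Ioi 0).indicator fun t : ℝ => r * Complex.exp (-(r + z) * t) := by
    have h0 : ∀ᵐ t : ℝ, t ≠ 0 := by simp [ae_iff]
    filter_upwards [h0] with t ht
    rw [exponentialPDF_eq]
    rcases lt_or_gt_of_ne ht with h | h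
    · rw [if_neg h.not_ge, Set.indicator_of_notMem (by simpa using h.le)]
      simp
    · rw [if_pos h.le, Set.indicator_of_mem (by simpa using h), ENNReal.toReal_ofReal (by positivity),
        Complex.real_smul]
      push_cast
      rw [mul_assoc, ← Complex.exp_add]
      congr 2
      ring
  rw [integral_congr_ae h2, integral_indicator measurableSet_Ioi, integral_const_mul,
    integral_exp_mul_complex_Ioi (by simp; linarith)]
  have h3 : (r : ℂ) + z ≠ 0 := fun h => by
    have := congrArg Complex.re h
    simp at this
    linarith
  simp only [Complex.ofReal_zero, mul_zero, Complex.exp_zero]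
  field_simp

/-! ### The law at an independent exponential time -/

namespace LevyTriplet

variable {n : ℕ} {T : LevyTriplet n} {Ω : Type*} [MeasurableSpace Ω]
  {P : Measure Ω} [IsProbabilityMeasure P]
  {X : ℝ≥0 → Ω → EuclideanSpace ℝ (Fin n)} {τ : Ω → ℝ≥0} {r : ℝ}

lemma re_exponent_nonneg {p : ℝ≥0 → Measure (EuclideanSpace ℝ (Fin n))}
    (hp : T.IsSemigroupOf p) (ξ : EuclideanSpace ℝ (Fin n)) : 0 ≤ (T.exponent ξ).re := by
  have := hp.1 1
  have h := norm_charFun_le_one (μ := p 1) ξ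
  rw [hp.2, Complex.norm_exp, Real.exp_le_one_iff] at h
  simpa using h

/-- The characteristic function of a Lévy process at an independent exponential time. -/
lemma charFun_map_eval_time (hr : 0 < r) (hX : ∀ t, Measurable (X t)) (hτ : Measurable τ)
    (hcont : ∀ᵐ ω ∂P, ∀ t, ContinuousWithinAt (fun s => X s ω) (Set.Ioi t) t)
    (hind : IndepFun τ (fun ω t => X t ω) P)
    (hlaw : P.map (fun ω => (τ ω : ℝ)) = expMeasure r)
    (hp : T.IsSemigroupOf fun t => P.map (X t)) (ξ : EuclideanSpace ℝ (Fin n)) :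
    charFun (P.map fun ω => X (τ ω) ω) ξ * (r + T.exponent ξ) = r := by
  have hre := re_exponent_nonneg hp ξ
  have hfc : Continuous fun x : EuclideanSpace ℝ (Fin n) =>
      Complex.exp ((⟪x, ξ⟫ : ℝ) * Complex.I) := by fun_prop
  have hlim := tendsto_integral_eval_roundUp hX hτ hcont hind hfc
    (C := 1) (fun x => (Complex.norm_exp_ofReal_mul_I _).le)
  have hg : ∀ t, ∫ ω, Complex.exp ((⟪X t ω, ξ⟫ : ℝ) * Complex.I) ∂P
      = Complex.exp (-(t : ℝ) * T.exponent ξ) := fun t => by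
    rw [← hp.2, charFun_apply, integral_map (hX t).aemeasurable hfc.aestronglyMeasurable]
  simp_rw [hg] at hlim
  have hlim2 : Filter.Tendsto
      (fun k => ∫ ω, Complex.exp (-((NNReal.roundUp k (τ ω) : ℝ≥0) : ℝ) * T.exponent ξ) ∂P)
      Filter.atTop (𝓝 (∫ ω, Complex.exp (-(τ ω : ℝ) * T.exponent ξ) ∂P)) := by
    refine tendsto_integral_of_dominated_convergence (fun _ => 1) (fun k => ?_)
      (integrable_const 1) (fun k => Filter.Eventually.of_forall fun ω => ?_)
      (Filter.Eventually.of_forall fun ω => ?_)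
    · have h1 : Measurable fun ω => NNReal.roundUp k (τ ω) := by
        unfold NNReal.roundUp
        fun_prop
      exact Measurable.aestronglyMeasurable (by fun_prop)
    · rw [Complex.norm_exp, Real.exp_le_one_iff, ← Complex.ofReal_neg, Complex.re_ofReal_mul]
      exact mul_nonpos_of_nonpos_of_nonneg (by simp) hre
    · have h1 := (NNReal.tendsto_roundUp (τ ω)).mono_right nhdsWithin_le_nhds
      have h2 : Continuous fun t : ℝ≥0 => Complex.exp (-(t : ℝ) * T.exponent ξ) := by fun_prop
      exact (h2.tendsto _).comp h1
  -- Two limits of the same discretized expectations: by right-continuity of paths and by continuity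
  -- of t ↦ e^{-tψ}.
  have h1 := tendsto_nhds_unique hlim hlim2
  have h2 : ∫ ω, Complex.exp (-(τ ω : ℝ) * T.exponent ξ) ∂P = r / (r + T.exponent ξ) := by
    rw [← integral_cexp_neg_mul_expMeasure hr hre, ← hlaw,
      integral_map (by fun_prop) (by fun_prop)]
  have h3 : (r : ℂ) + T.exponent ξ ≠ 0 := fun h => by
    have := congrArg Complex.re h
    simp at this
    linarith
  rw [charFun_apply, integral_map (aemeasurable_eval_time hX hτ hcont) hfc.aestronglyMeasurable,
    h1, h2, div_mul_cancel₀ _ h3]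

end LevyTriplet

/-! ### Vague density by annihilators -/

section Duality

variable {S : Type*} [TopologicalSpace S] [MeasurableSpace S]

lemma ZeroAtInftyContinuousMap.integrable_signedMeasure [OpensMeasurableSpace S]
    [SecondCountableTopology S] (m : SignedMeasure S) (φ : C₀(S, ℝ)) : m.Integrable φ :=
  have : IsFiniteMeasure m.variation := by
    rw [← SignedMeasure.totalVariation_eq_variation]
    infer_instance
  (integrable_const ‖φ‖).mono' (map_continuous φ).aestronglyMeasurable
    (Filter.Eventually.of_forall fun y => φ.abs_apply_le_norm y)

variable [OpensMeasurableSpace S] [SecondCountableTopology S]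

variable (S) in
/-- The pairing between functions vanishing at infinity and signed measures. -/
def vaguePairing : C₀(S, ℝ) →ₗ[ℝ] SignedMeasure S →ₗ[ℝ] ℝ :=
  LinearMap.mk₂ ℝ (fun φ m => ∫ᵛ y, φ y ∂<•m)
    (fun φ ψ m => VectorMeasure.integral_add (φ.integrable_signedMeasure m)
      (ψ.integrable_signedMeasure m))
    (fun c φ m => VectorMeasure.integral_fun_smul m _ c φ)
    (fun φ m m' => VectorMeasure.integral_add_vectorMeasure (φ.integrable_signedMeasure m)
      (φ.integrable_signedMeasure m'))
    (fun c φ _ => VectorMeasure.integral_smul_vectorMeasure φ c)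

lemma vaguePairing_apply (φ : C₀(S, ℝ)) (m : SignedMeasure S) :
    vaguePairing S φ m = ∫ᵛ y, φ y ∂<•m := rfl

/-- A basic vague neighbourhood involves finitely many test functions, so separation takes place in
ℝ^I. A functional there that vanishes on the image of M but not at that of x is pairing with a
combination of the members of I; this combination annihilates M, so it is zero. -/
lemma exists_mem_forall_vaguePairing_eq {M : Submodule ℝ (SignedMeasure S)}
    (hM : ∀ φ : C₀(S, ℝ), (∀ m ∈ M, vaguePairing S φ m = 0) → φ = 0) (I : Finset C₀(S, ℝ))
    (x : SignedMeasure S) : ∃ m ∈ M, ∀ φ ∈ I, vaguePairing S φ m = vaguePairing S φ x := by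
  classical
  let π : SignedMeasure S →ₗ[ℝ] (I → ℝ) := LinearMap.pi fun φ => vaguePairing S φ.1
  by_cases hx : π x ∈ M.map π
  · obtain ⟨m, hm, hmx⟩ := hx
    exact ⟨m, hm, fun φ hφ => congrFun hmx ⟨φ, hφ⟩⟩
  · exfalso
    obtain ⟨f, hf, hfM⟩ := Submodule.exists_le_ker_of_notMem hx
    let φ₀ : C₀(S, ℝ) := ∑ i : I, f (fun j => if i = j then 1 else 0) • i.1
    have h1 : ∀ m, vaguePairing S φ₀ m = f (π m) := by
      intro m
      rw [LinearMap.pi_apply_eq_sum_univ f (π m)]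
      simp only [φ₀, map_sum, LinearMap.sum_apply, map_smul, LinearMap.smul_apply, smul_eq_mul]
      exact Finset.sum_congr rfl fun i _ => mul_comm _ _
    have h2 : φ₀ = 0 := hM φ₀ fun m hm => by
      rw [h1]
      exact hfM (Submodule.mem_map_of_mem hm)
    apply hf
    rw [← h1, h2]
    simp

/-- A subspace of signed measures with trivial annihilator is vaguely dense. -/
theorem vaguelyDense_of_forall_eq_zero {M : Submodule ℝ (SignedMeasure S)}
    (hM : ∀ φ : C₀(S, ℝ), (∀ m ∈ M, ∫ᵛ y, φ y ∂<•m = 0) → φ = 0) :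
    VaguelyDense (M : Set (SignedMeasure S)) := by
  let _ := vagueTopology S
  have hind : IsInducing fun (m : SignedMeasure S) (φ : C₀(S, ℝ)) => ∫ᵛ y, φ y ∂<•m := ⟨rfl⟩
  refine hind.dense_iff.2 fun x => mem_closure_iff.2 fun U hU hxU => ?_
  obtain ⟨I, u, hu, hIu⟩ := isOpen_pi_iff.1 hU _ hxU
  obtain ⟨m, hm, hmx⟩ := exists_mem_forall_vaguePairing_eq hM I x
  refine ⟨_, hIu fun φ hφ => ?_, m, hm, rfl⟩
  have h1 := (hu φ hφ).2
  rw [← vaguePairing_apply, ← hmx φ hφ] at h1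
  exact h1

end Duality

/-! ### Extension by zero from an open set -/

section ExtendByZero

variable {X : Type*} [TopologicalSpace X] [T2Space X] {U : Set X}

open scoped Classical in
/-- Extension by zero of a function vanishing at infinity on an open set. -/
def ZeroAtInftyContinuousMap.extendByZero (hU : IsOpen U) (φ : C₀(U, ℝ)) : C₀(X, ℝ) :=
  -- Smallness off a compact subset of U gives both continuity at points outside U and decay at
  -- infinity.
  have key : ∀ δ > 0, ∃ K : Set X, IsCompact K ∧ K ⊆ U ∧
      ∀ x ∉ K, |if h : x ∈ U then φ ⟨x, h⟩ else 0| < δ := by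
    intro δ hδ
    have h1 : ∀ᶠ y in Filter.cocompact U, |φ y| < δ := by
      have := (zero_at_infty φ).abs
      rw [abs_zero] at this
      exact this.eventually_lt_const hδ
    obtain ⟨K, hK, hKφ⟩ := Filter.mem_cocompact.1 h1
    refine ⟨(↑) '' K, hK.image continuous_subtype_val, by simp, fun x hx => ?_⟩
    split_ifs with h
    · exact hKφ (show (⟨x, h⟩ : U) ∈ Kᶜ from fun hmem => hx ⟨_, hmem, rfl⟩)
    · simpa using hδ
  { toFun := fun x => if h : x ∈ U then φ ⟨x, h⟩ else 0
    continuous_toFun := by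
      refine continuous_iff_continuousAt.2 fun x => ?_
      by_cases hx : x ∈ U
      · refine (hU.isOpenEmbedding_subtypeVal.continuousAt_iff (x := ⟨x, hx⟩)).1 ?_
        have : ((fun x => if h : x ∈ U then φ ⟨x, h⟩ else 0) ∘ ((↑) : U → X)) = φ := by
          ext y
          simp
        rw [this]
        exact (map_continuous φ).continuousAt
      · refine Metric.tendsto_nhds.2 fun δ hδ => ?_
        obtain ⟨K, hK, hKU, hKφ⟩ := key δ hδ
        filter_upwards [hK.isClosed.isOpen_compl.mem_nhds fun h => hx (hKU h)] with z hz
        rw [dif_neg hx, Real.dist_0_eq_abs]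
        exact hKφ z hz
    zero_at_infty' := by
      refine Metric.tendsto_nhds.2 fun δ hδ => ?_
      obtain ⟨K, hK, hKU, hKφ⟩ := key δ hδ
      filter_upwards [hK.compl_mem_cocompact] with z hz
      rw [Real.dist_0_eq_abs]
      exact hKφ z hz }

namespace ZeroAtInftyContinuousMap

variable (hU : IsOpen U) (φ : C₀(U, ℝ))

@[simp] lemma extendByZero_coe (y : U) : extendByZero hU φ y = φ y := dif_pos y.2

lemma extendByZero_of_notMem {x : X} (hx : x ∉ U) : extendByZero hU φ x = 0 := dif_neg hx

end ZeroAtInftyContinuousMap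

end ExtendByZero

/-! ### Integration against shifted and restricted laws -/

section Exterior

open ZeroAtInftyContinuousMap

variable {n : ℕ} {ε : ℝ}

lemma isOpen_exterior (n : ℕ) (ε : ℝ) : IsOpen (Exterior n ε) :=
  Metric.isClosed_closedBall.isOpen_compl

lemma integral_shiftRestrict (μ : Measure (EuclideanSpace ℝ (Fin n))) [IsFiniteMeasure μ]
    (x : EuclideanSpace ℝ (Fin n)) (φ : C₀(Exterior n ε, ℝ)) :
    ∫ᵛ y, φ y ∂<•(shiftRestrict μ ε x)
      = ∫ z, extendByZero (isOpen_exterior n ε) φ (-x + z) ∂μ := by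
  let e : Exterior n ε → EuclideanSpace ℝ (Fin n) := fun y => x + y
  have he : MeasurableEmbedding e := ((Homeomorph.addLeft x).isOpenEmbedding.comp
    (isOpen_exterior n ε).isOpenEmbedding_subtypeVal).measurableEmbedding
  rw [shiftRestrict, VectorMeasure.integral_toSignedMeasure]
  calc ∫ y, φ y ∂(μ.comap e)
      = ∫ y, extendByZero (isOpen_exterior n ε) φ (-x + e y) ∂(μ.comap e) := by
        congr 1 with y
        rw [neg_add_cancel_left, extendByZero_coe]
    _ = ∫ z in Set.range e, extendByZero (isOpen_exterior n ε) φ (-x + z) ∂μ := by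
        rw [← he.map_comap, he.integral_map]
    _ = _ := by
        refine setIntegral_eq_integral_of_forall_compl_eq_zero fun z hz =>
          extendByZero_of_notMem _ _ fun h => hz ⟨⟨_, h⟩, ?_⟩
        simp [e]

lemma eq_zero_of_extendByZero_eq_zero {φ : C₀(Exterior n ε, ℝ)}
    (h : extendByZero (isOpen_exterior n ε) φ = 0) : φ = 0 := by
  ext y
  rw [← extendByZero_coe (isOpen_exterior n ε), h]
  rfl

end Exterior

/-! ### Vanishing of annihilating functions -/

section Main

open ZeroAtInftyContinuousMap

variable {n : ℕ} {T : LevyTriplet n} {Ω : Type*} [MeasurableSpace Ω]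
  {P : Measure Ω} [IsProbabilityMeasure P]
  {X : ℝ≥0 → Ω → EuclideanSpace ℝ (Fin n)} {τ : Ω → ℝ≥0} {r : ℝ}

lemma LevyTriplet.UniqueContinuation.eq_zero_of_integral_eval_time_eq_zero
    (hT : T.UniqueContinuation) (hr : 0 < r) (hX : ∀ t, Measurable (X t)) (hτ : Measurable τ)
    (hcont : ∀ᵐ ω ∂P, ∀ t, ContinuousWithinAt (fun s => X s ω) (Set.Ioi t) t)
    (hind : IndepFun τ (fun ω t => X t ω) P)
    (hlaw : P.map (fun ω => (τ ω : ℝ)) = expMeasure r)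
    (hp : T.IsSemigroupOf fun t => P.map (X t)) {ε : ℝ} (hε : 0 < ε) {φ : C₀(Exterior n ε, ℝ)}
    (h : ∀ x ∈ Metric.ball (0 : EuclideanSpace ℝ (Fin n)) ε,
      ∫ z, extendByZero (isOpen_exterior n ε) φ (x + z) ∂(P.map fun ω => X (τ ω) ω) = 0) :
    φ = 0 := by
  have hprob : IsProbabilityMeasure (P.map fun ω => X (τ ω) ω) :=
    Measure.isProbabilityMeasure_map (aemeasurable_eval_time hX hτ hcont)
  refine eq_zero_of_extendByZero_eq_zero (hT.eq_zero_of_integral_eq_zero hp hr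
    (charFun_map_eval_time hr hX hτ hcont hind hlaw hp) Metric.isOpen_ball
    ⟨0, Metric.mem_ball_self hε⟩ (fun x hx => ?_) h)
  exact extendByZero_of_notMem _ _ fun hx' => hx' (Metric.ball_subset_closedBall hx)

/-- The space Ω need not carry an independent exponential time, so one is adjoined as a second
factor. Its discretizations are positive and mix vanishing averages, so the average at that time
vanishes in the limit. -/
lemma LevyTriplet.UniqueContinuation.eq_zero_of_integral_eval_eq_zero
    (hT : T.UniqueContinuation) (hX : ∀ t, Measurable (X t))
    (hcont : ∀ᵐ ω ∂P, ∀ t, ContinuousWithinAt (fun s => X s ω) (Set.Ioi t) t)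
    (hp : T.IsSemigroupOf fun t => P.map (X t)) {ε : ℝ} (hε : 0 < ε) {φ : C₀(Exterior n ε, ℝ)}
    (h : ∀ x ∈ Metric.ball (0 : EuclideanSpace ℝ (Fin n)) ε, ∀ t : ℝ≥0, 0 < t →
      ∫ z, extendByZero (isOpen_exterior n ε) φ (x + z) ∂(P.map (X t)) = 0) :
    φ = 0 := by
  have hexp := isProbabilityMeasure_expMeasure one_pos
  let ρ : Measure ℝ≥0 := (expMeasure 1).map Real.toNNReal
  have hρ : IsProbabilityMeasure ρ := Measure.isProbabilityMeasure_map (by fun_prop)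
  have hmap : ∀ t, (P.prod ρ).map (fun q => X t q.1) = P.map (X t) := fun t => by
    have := Measure.map_map (μ := P.prod ρ) (hX t) measurable_fst
    rw [measurePreserving_fst.map_eq] at this
    exact this.symm
  have hX' : ∀ t, Measurable fun q : Ω × ℝ≥0 => X t q.1 := fun t => (hX t).comp measurable_fst
  have hcont' : ∀ᵐ q ∂(P.prod ρ), ∀ t, ContinuousWithinAt (fun s => X s q.1) (Set.Ioi t) t :=
    measurePreserving_fst.quasiMeasurePreserving.ae hcont
  have hind : IndepFun (Prod.snd : Ω × ℝ≥0 → ℝ≥0) (fun q t => X t q.1) (P.prod ρ) :=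
    (indepFun_prod (X := fun ω t => X t ω) (Y := id) (measurable_pi_lambda _ hX)
      measurable_id).symm
  have hlaw : (P.prod ρ).map (fun q => (q.2 : ℝ)) = expMeasure 1 := by
    have h1 := Measure.map_map (μ := P.prod ρ) measurable_coe_nnreal_real measurable_snd
    rw [measurePreserving_snd.map_eq, Measure.map_map measurable_coe_nnreal_real (by fun_prop)] at h1
    refine h1.symm.trans ?_
    have h2 : ∀ᵐ t ∂(expMeasure 1), 0 ≤ t := by
      have h3 : expMeasure 1 = volume.withDensity (exponentialPDF 1) := rfl
      have hm : Measurable (exponentialPDF 1) :=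
        (measurable_exponentialPDFReal 1).ennreal_ofReal
      rw [h3, ae_withDensity_iff hm]
      refine Filter.Eventually.of_forall fun t ht => ?_
      by_contra hlt
      exact ht (exponentialPDF_of_neg (not_le.1 hlt))
    conv_rhs => rw [← Measure.map_id (μ := expMeasure 1)]
    exact Measure.map_congr (h2.mono fun t ht => Real.coe_toNNReal t ht)
  have hp' : T.IsSemigroupOf fun t => (P.prod ρ).map fun q => X t q.1 := by
    simpa only [hmap] using hp
  refine hT.eq_zero_of_integral_eval_time_eq_zero one_pos hX' measurable_snd hcont' hind hlaw hp'
    hε fun x hx => ?_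
  have hf : Continuous fun z => extendByZero (isOpen_exterior n ε) φ (x + z) :=
    (map_continuous _).comp (continuous_const.add continuous_id)
  have hlim := tendsto_integral_eval_roundUp hX' measurable_snd hcont' hind hf
    (fun z => (extendByZero (isOpen_exterior n ε) φ).abs_apply_le_norm _)
  have h0 : ∀ t : ℝ≥0, 0 < t →
      ∫ q, extendByZero (isOpen_exterior n ε) φ (x + X t q.1) ∂(P.prod ρ) = 0 := fun t ht => by
    rw [← h x hx t ht, ← hmap t, integral_map (hX' t).aemeasurable hf.aestronglyMeasurable]
  rw [integral_map (aemeasurable_eval_time hX' measurable_snd hcont') hf.aestronglyMeasurable]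
  refine tendsto_nhds_unique hlim ?_
  have h1 : ∀ (k : ℕ) (q : Ω × ℝ≥0), ∫ q', extendByZero (isOpen_exterior n ε) φ
      (x + X (NNReal.roundUp k q.2) q'.1) ∂(P.prod ρ) = 0 := fun k q =>
    h0 _ (zero_le.trans_lt (NNReal.lt_roundUp k q.2))
  simp_rw [h1, integral_zero]
  exact tendsto_const_nhds

end Main

end

theorem corollary3p3 {n : ℕ} (T : LevyTriplet n) {Ω : Type*} [MeasurableSpace Ω]
    (P : Measure Ω) [IsProbabilityMeasure P]
    (X : ℝ≥0 → Ω → EuclideanSpace ℝ (Fin n)) (hX : IsLevyProcessOf T X P)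
    (hT : T.UniqueContinuation) (ε : ℝ) (hε : 0 < ε) :
    (∀ (r : ℝ) (τ : Ω → ℝ≥0), IsIndepExpTime X P r τ →
      VaguelyDense (Submodule.span ℝ
        {m : SignedMeasure (Exterior n ε) | ∃ x ∈ Metric.ball (0 : EuclideanSpace ℝ (Fin n)) ε,
          m = shiftRestrict (P.map (fun ω => X (τ ω) ω)) ε x} : Set (SignedMeasure (Exterior n ε)))) ∧
    VaguelyDense (Submodule.span ℝ
      {m : SignedMeasure (Exterior n ε) | ∃ x ∈ Metric.ball (0 : EuclideanSpace ℝ (Fin n)) ε,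
        ∃ t : ℝ≥0, 0 < t ∧
          m = shiftRestrict (P.map (X t)) ε x} : Set (SignedMeasure (Exterior n ε))) := by
  have hp : T.IsSemigroupOf fun t => P.map (X t) :=
    ⟨fun t => Measure.isProbabilityMeasure_map (hX.measurable t).aemeasurable, hX.charFun_eq⟩
  refine ⟨fun r τ hτ => vaguelyDense_of_forall_eq_zero fun φ hφ =>
    hT.eq_zero_of_integral_eval_time_eq_zero hτ.rate_pos hX.measurable hτ.measurable
      hX.right_continuous hτ.indep hτ.law hp hε fun x hx => ?_,
    vaguelyDense_of_forall_eq_zero fun φ hφ =>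
    hT.eq_zero_of_integral_eval_eq_zero hX.measurable hX.right_continuous hp hε
      fun x hx t ht => ?_⟩
  -- The shift by x pairs with φ extended by zero at z - x; the ball is symmetric, so the sign is
  -- flipped.
  · have := hφ _ (Submodule.subset_span ⟨-x, by simpa using hx, rfl⟩)
    rwa [integral_shiftRestrict, neg_neg] at this
  · have := hφ _ (Submodule.subset_span ⟨-x, by simpa using hx, t, ht, rfl⟩)
    rwa [integral_shiftRestrict, neg_neg] at this
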